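/- **Setting.** Let $n\ge 3$ and let $\mathbb G$ be a simple graph on $\{1,\dots,n\}$ with $m$ labelled, oriented edges. For $x=(x_1,\dots,x_n)\in(\mathbb R^2)^n$ put $z_k(x)=x_i-x_j$, where $i$ is the head and $j$ the tail of edge $k$, let $R(x)=\tfrac12\,\partial(\|z_1\|^2,\dots,\|z_m\|^2)/\partial x$ be the rigidity matrix, and let $S(x)$ be the $m\times 2n$ matrix whose $k$th row has $z_k'$ in the block of the tail of $k$ and $0$ elsewhere. The formation $\{\mathbb G,x\}$ is infinitesimally rigid if $\operatorname{rank}R(x)=2n-3$, and minimally so if moreover removing any edge destroys this. Let $d_1,\dots,d_m>0$ and let $y$ be a target multi-point: $\|z_k(y)\|=d_k$ for all $k$, and every $\{\mathbb G,x\}$ with $\|z_k(x)\|=d_k$ for all $k$ is infinitesimally rigid. Put $e_k(x)=\|z_k(x)\|^2-d_k^2$. For a mismatch error $\mu\in\mathbb R^m$ the overall system is $$\dot x=-R(x)'e(x)+S(x)'\mu .$$ Let $T$ be a set of edges such that the subformation with edges $T$ is minimally infinitesimally rigid at $y$ (such $T$ exists); write $\tilde e$ for the entries of $e$ with label in $T$,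 $\hat e$ for the others, $\tilde R$ for the rows of $R$ with label in $T$. Consider * an ambient space $\mathcal A$: an open set containing $y$, invariant under rotations and translations, on which each $(x_i-x_j)'(x_k-x_l)$ is a smooth function of $\tilde e(x)$ and the subformation with edges $T$ is minimally infinitesimally rigid; * the smooth maps $\psi$ on $\tilde e(\mathcal A)$ and $g$ on $\tilde e(\mathcal A)\times\mathbb R^m$ with, for all $x\in\mathcal A$, $\hat e=\psi(\tilde e)$ and $g(\tilde e,\mu)=-2\tilde R\tilde R'\tilde e-2\tilde R\tilde R'F(\tilde e)'\psi(\tilde e)+2\tilde RS'\mu$, where $F=\partial\psi/\partial\tilde e$ (the error system is $\dot\epsilon=g(\epsilon,\mu)$); * an open ball $\mathcal B$ about $0$ with $\mathcal B\subset\tilde e(\mathcal A)$ and $\overline{\mathcal A_{\mathcal B}}\subset\mathcal A$, where $\mathcal A_{\mathcal B}=\{x\in\mathcal A:\tilde e(x)\in\mathcal B\}$; * an open neighbourhood $\mathcal M$ of $0$ in $\mathbb R^m$ and a smooth map $\mu\mapsto\epsilon_\mu\in\tilde e(\mathcal A)$ on $\mathcal M$ with $\epsilon_0=0$ and $g(\epsilon_\mu,\mu)=0$.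 Such objects exist. Let $\mathfrak e_\mu\in\mathbb R^m$ be the vector whose entries with label in $T$ form $\epsilon_\mu$ and whose other entries form $\psi(\epsilon_\mu)$. An equilibrium-error solution for $\mu$ is a solution $x(t)$, $t\ge 0$, of the overall system in $\mathcal A_{\mathcal B}$ with $e(x(t))=\mathfrak e_\mu$ for all $t\ge0$. **Proposition 3.** Suppose that $y$ is unaligned: $(y_i-y_j)\wedge(y_k-y_l)\neq0$ for any four distinct indices $i,j,k,l$, where $p\wedge q=\det[p\;q]$. Then, for every choice of the objects above, there is an open set $\mathcal M_0\subset\mathcal M$ containing $0$, and a subset $\mathcal V\subset\mathcal M_0$ open and dense in $\mathcal M_0$, such that for every $\mu\in\mathcal M_0$ an equilibrium-error solution for $\mu$ exists, and $z(x(t))$ is nonconstant on $[0,\infty)$ along an equilibrium-error solution $x(t)$ for $\mu$ if and only if $\mu\in\mathcal V$. -/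

import Mathlib

open scoped ContDiff Matrix

/-- Multi-points: `n` points of the plane, the `i`-th point being `x i`. Squared Euclidean norms and
inner products of plane vectors are written with the dot product `⬝ᵥ`. -/
abbrev MultiPoint (n : ℕ) : Type := Fin n → Fin 2 → ℝ

/-- The wedge product `p ∧ q = det [p q]` of two plane vectors. -/
def wedge (p q : Fin 2 → ℝ) : ℝ := p 0 * q 1 - p 1 * q 0

/-- A multi-point is unaligned if, for any four of its points, the line through the first two is
not parallel to the line through the last two. -/
def Unaligned {n : ℕ} (x : MultiPoint n) : Prop :=
  ∀ i j k l : Fin n, i ≠ j → i ≠ k → i ≠ l → j ≠ k → j ≠ l → k ≠ l →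
    wedge (x i - x j) (x k - x l) ≠ 0

/-- A labelling of the edges of `G` by `1, …, m` together with an orientation of every edge. -/
structure OrientedLabelling {n : ℕ} (G : SimpleGraph (Fin n)) (m : ℕ) where
  head : Fin m → Fin n
  tail : Fin m → Fin n
  bijOn : Set.BijOn (fun k => s(head k, tail k)) Set.univ G.edgeSet

namespace OrientedLabelling

variable {n m : ℕ} {G : SimpleGraph (Fin n)} (E : OrientedLabelling G m)

/-- The relative positions: `z_k = x_i - x_j` where `i` is the head and `j` the tail of edge `k`. -/
def z (x : MultiPoint n) (k : Fin m) : Fin 2 → ℝ := x (E.head k) - x (E.tail k)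

/-- The matrix `H`: `1` at the head, `-1` at the tail, `0` elsewhere. -/
def H (k : Fin m) (i : Fin n) : ℝ :=
  if E.head k = i then 1 else if E.tail k = i then -1 else 0

/-- The rigidity matrix `R`, whose entry in row `k` at coordinate `a` of point `i` is
`h_{ki} (z_k)_a`. -/
def R (x : MultiPoint n) : Matrix (Fin m) (Fin n × Fin 2) ℝ :=
  Matrix.of fun k c => E.H k c.1 * E.z x k c.2

/-- The matrix `S`, obtained like `R` from the matrix that results when the negative entries
of `-H` are replaced by zeros. -/
def S (x : MultiPoint n) : Matrix (Fin m) (Fin n × Fin 2) ℝ :=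
  Matrix.of fun k c => max (-E.H k c.1) 0 * E.z x k c.2

/-- The rigidity matrix of the formation whose graph is the spanning subgraph of `G` with edge
labels in `T`: the rows of `R` with label in `T`. -/
def Rred (T : Finset (Fin m)) (x : MultiPoint n) : Matrix T (Fin n × Fin 2) ℝ :=
  Matrix.of fun k c => E.R x k.1 c

/-- `{G, x}` is infinitesimally rigid. -/
def InfRigid (x : MultiPoint n) : Prop := (E.R x).rank = 2 * n - 3

/-- The formation with the edges in `T` is infinitesimally rigid at `x`. -/
def InfRigidOn (T : Finset (Fin m)) (x : MultiPoint n) : Prop := (E.Rred T x).rank = 2 * n - 3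

/-- The formation with the edges in `T` is minimally infinitesimally rigid at `x`: it is
infinitesimally rigid, and it is no longer so once any edge is removed. -/
def MinInfRigidOn (T : Finset (Fin m)) (x : MultiPoint n) : Prop :=
  E.InfRigidOn T x ∧ ∀ k ∈ T, ¬ E.InfRigidOn (T.erase k) x

/-- `{G, y}` is a target formation for the target distances `d_k`: the distances are positive and
realized by `y`, and every formation that realizes them, `{G, y}` included, is infinitesimally
rigid. -/
structure IsTarget (d : Fin m → ℝ) (y : MultiPoint n) : Prop where
  pos : ∀ k, 0 < d k
  realizes : ∀ k, E.z y k ⬝ᵥ E.z y k = d k ^ 2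
  infRigid : ∀ x : MultiPoint n, (∀ k, E.z x k ⬝ᵥ E.z x k = d k ^ 2) → E.InfRigid x

variable (d : Fin m → ℝ)

/-- The error `e_k = ‖z_k‖² - d_k²`, as a function of the multi-point. -/
def err (x : MultiPoint n) : Fin m → ℝ := fun k => E.z x k ⬝ᵥ E.z x k - d k ^ 2

/-- The right-hand side of the overall system: `ẋ_i` is minus the sum of `e_k z_k` over the edges
with head `i` plus the sum of `(e_k + μ_k) z_k` over the edges with tail `i`. -/
def field (x : MultiPoint n) (μ : Fin m → ℝ) : MultiPoint n := fun i =>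
  -(∑ k with E.head k = i, E.err d x k • E.z x k)
    + ∑ k with E.tail k = i, (E.err d x k + μ k) • E.z x k

variable (T : Finset (Fin m))

/-- The reduced error: the entries of the error with label in `T`. -/
def redErr (x : MultiPoint n) : T → ℝ := fun k => E.err d x k.1

/-- The entries of the error with label outside `T`. -/
def hatErr (x : MultiPoint n) : ↥(Tᶜ) → ℝ := fun k => E.err d x k.1

/-- The error with reduced part `ε` and remaining part `δ`. -/
def assemble (ε : T → ℝ) (δ : ↥(Tᶜ) → ℝ) : Fin m → ℝ := fun k =>
  if h : k ∈ T then ε ⟨k, h⟩ else δ ⟨k, Finset.mem_compl.mpr h⟩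

/-- `A` is an ambient space: an open set containing `y`, invariant under rotations and
translations, on which every inner product `(x_i - x_j)'(x_k - x_l)` is a smooth function of the
reduced error, and at every point of which the reduced formation is minimally infinitesimally
rigid. -/
structure IsAmbient (y : MultiPoint n) (A : Set (MultiPoint n)) : Prop where
  isOpen : IsOpen A
  mem : y ∈ A
  invariant : ∀ Q ∈ Matrix.specialOrthogonalGroup (Fin 2) ℝ, ∀ b : Fin 2 → ℝ, ∀ x ∈ A,
    (fun i => Q *ᵥ x i + b) ∈ A
  inner : ∀ i j k l : Fin n, ∃ η : (T → ℝ) → ℝ,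
    ContDiffOn ℝ ∞ η (E.redErr d T '' A) ∧
      ∀ x ∈ A, (x i - x j) ⬝ᵥ (x k - x l) = η (E.redErr d T x)
  minInfRigid : ∀ x ∈ A, E.MinInfRigidOn T x

/-- `ψ` is the smooth function that gives, on `A`, the remaining errors in terms of the reduced
error. -/
structure IsDependency (A : Set (MultiPoint n)) (ψ : (T → ℝ) → (↥(Tᶜ) → ℝ)) : Prop where
  smooth : ContDiffOn ℝ ∞ ψ (E.redErr d T '' A)
  eq : ∀ x ∈ A, E.hatErr d T x = ψ (E.redErr d T x)

/-- The Jacobian matrix `F = ∂ψ/∂ε`. -/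
noncomputable def jac {T : Finset (Fin m)} (ψ : (T → ℝ) → (↥(Tᶜ) → ℝ)) (ε : T → ℝ) :
    Matrix ↥(Tᶜ) T ℝ :=
  LinearMap.toMatrix' (fderiv ℝ ψ ε : (T → ℝ) →ₗ[ℝ] (↥(Tᶜ) → ℝ))

/-- `ε' = g(ε, μ)` is the error system with ambient space `A`. -/
structure IsErrorSystem (A : Set (MultiPoint n)) (ψ : (T → ℝ) → (↥(Tᶜ) → ℝ))
    (g : (T → ℝ) → (Fin m → ℝ) → (T → ℝ)) : Prop where
  smooth : ContDiffOn ℝ ∞ (fun p : (T → ℝ) × (Fin m → ℝ) => g p.1 p.2)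
    ((E.redErr d T '' A) ×ˢ Set.univ)
  eq : ∀ x ∈ A, ∀ μ : Fin m → ℝ,
    g (E.redErr d T x) μ =
      -((2 : ℝ) • ((E.Rred T x * (E.Rred T x)ᵀ) *ᵥ E.redErr d T x))
      - (2 : ℝ) • ((E.Rred T x * (E.Rred T x)ᵀ) *ᵥ
          ((jac ψ (E.redErr d T x))ᵀ *ᵥ ψ (E.redErr d T x)))
      + (2 : ℝ) • ((E.Rred T x * (E.S x)ᵀ) *ᵥ μ)

/-- The open Euclidean ball of radius `r` about `0` in the space of reduced errors. -/
def errBall (r : ℝ) : Set (T → ℝ) := {ε | ∑ k, ε k ^ 2 < r ^ 2}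

/-- The set `A_B` of all `x ∈ A` with reduced error in the ball `B` of radius `r` about `0`. -/
def ballPart (A : Set (MultiPoint n)) (r : ℝ) : Set (MultiPoint n) :=
  {x | x ∈ A ∧ E.redErr d T x ∈ errBall T r}

/-- The objects attached to a target formation `{G, y}` and a reduced edge set `T`: an ambient
space `A`, the dependency map `ψ`, the error system `ε' = g(ε, μ)`, a ball `B` of radius `r` about
`0` with `B ⊆ {reduced errors of points of A}` and `closure A_B ⊆ A`, and an open neighbourhood
`M` of `0` with a smooth family `ε_μ`, `μ ∈ M`, of equilibria of the error system with
`ε_0 = 0`. -/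
structure IsSetting (y : MultiPoint n) (A : Set (MultiPoint n))
    (ψ : (T → ℝ) → (↥(Tᶜ) → ℝ)) (g : (T → ℝ) → (Fin m → ℝ) → (T → ℝ)) (r : ℝ)
    (M : Set (Fin m → ℝ)) (eps : (Fin m → ℝ) → (T → ℝ)) : Prop where
  ambient : E.IsAmbient d T y A
  dependency : E.IsDependency d T A ψ
  errorSystem : E.IsErrorSystem d T A ψ g
  radius_pos : 0 < r
  ball_subset : errBall T r ⊆ E.redErr d T '' A
  closure_subset : closure (E.ballPart d T A r) ⊆ A
  isOpen : IsOpen M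
  zero_mem : 0 ∈ M
  eps_smooth : ContDiffOn ℝ ∞ eps M
  eps_zero : eps 0 = 0
  eps_mem : ∀ μ ∈ M, eps μ ∈ E.redErr d T '' A
  equilibrium : ∀ μ ∈ M, g (eps μ) μ = 0

/-- `x` is, on `[0, ∞)`, a solution in `A_B` of the overall system with mismatch error `μ`, along
which the error is constantly equal to the equilibrium output attached to `ε_μ`. -/
structure IsEquilibriumSolution (A : Set (MultiPoint n)) (ψ : (T → ℝ) → (↥(Tᶜ) → ℝ)) (r : ℝ)
    (eps : (Fin m → ℝ) → (T → ℝ)) (μ : Fin m → ℝ) (x : ℝ → MultiPoint n) : Prop where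
  solution : ∀ t : ℝ, 0 ≤ t →
    HasDerivWithinAt x (E.field d (x t) μ) (Set.Ici 0) t
  mem : ∀ t : ℝ, 0 ≤ t → x t ∈ E.ballPart d T A r
  err_eq : ∀ t : ℝ, 0 ≤ t → E.err d (x t) = assemble T (eps μ) (ψ (eps μ))

/-- `z` is nonconstant along the trajectory `x` on `[0, ∞)`. -/
def NonconstantZ (x : ℝ → MultiPoint n) : Prop :=
  ∃ s t : ℝ, 0 ≤ s ∧ 0 ≤ t ∧ E.z (x s) ≠ E.z (x t)

end OrientedLabelling

/-! Differentiating the dependency of the remaining errors on the reduced error gives `R̂ = F R̃`,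
so the error system is `g = 2 R̃ ẋ`. At an equilibrium error the velocity therefore preserves the
lengths of the edges in `T` to first order, and infinitesimal rigidity makes it the velocity of a
plane motion with some angular velocity `θ`. Since the overall system commutes with rotations and
translations, the formation then moves rigidly, which gives an equilibrium-error solution. Along any
such solution `z` is constant exactly when `θ` vanishes.

To detect `θ`, take moments about the centroid. The forces `e_k z_k` act oppositely at the two ends
of an edge and cancel, while a mismatch acts at the tail alone. Hence `θ`, up to a positive factor,
is `∑ μ_k τ_k`, where `τ_k` is the `torque` of edge `k` (`sum_torque_eq_zero_iff`). A product of two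
torques is a polynomial in inner products, hence a smooth function `Γ_kl` of the reduced error.
Rigidity provides an edge `l` with `τ_l(y) ≠ 0` (`exists_torque_ne_zero`). Put `q(μ) = ∑ μ_k
Γ_kl(ε_μ)`; near `0` it vanishes exactly when `θ` does. Its derivative at `0` in the direction of
`μ_l` is `τ_l(y)² > 0`, so `q` vanishes on no open set near `0`, and `{q ≠ 0}` is the required open
dense set.

The objects of the setting come from an analytic local section `σ` of the reduced error map through
`y`: the ambient space is the tube of all formations congruent to some `σ ε`, and the equilibria
come from the inverse function theorem. -/

/-! ### Infinitesimal motions of the plane. -/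

/-- Rotation of a plane vector by a right angle. -/
def quarterTurn (v : Fin 2 → ℝ) : Fin 2 → ℝ := ![-v 1, v 0]

/-- The action of `v ↦ Q v + b` on multi-points. -/
def moveBy {n : ℕ} (Q : Matrix (Fin 2) (Fin 2) ℝ) (b : Fin 2 → ℝ) (x : MultiPoint n) :
    MultiPoint n := fun i => Q *ᵥ x i + b

/-- The velocity field of an infinitesimal motion of the plane. -/
def trivialMotion {n : ℕ} (x : MultiPoint n) : ((Fin 2 → ℝ) × ℝ) →ₗ[ℝ] MultiPoint n where
  toFun p i := p.1 + p.2 • quarterTurn (x i)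
  map_add' p q := by ext i a; simp; ring
  map_smul' c p := by ext i a; simp; ring

theorem trivialMotion_apply {n : ℕ} (x : MultiPoint n) (b : Fin 2 → ℝ) (θ : ℝ) (i : Fin n) :
    trivialMotion x (b, θ) i = b + θ • quarterTurn (x i) := rfl

/-- A rotation with nonzero angular velocity has a single centre, so it cannot vanish at two
distinct points. This makes the space of trivial motions three-dimensional. -/
theorem trivialMotion_injective {n : ℕ} {x : MultiPoint n} {i j : Fin n} (hij : x i ≠ x j) :
    Function.Injective (trivialMotion x) := by
  rw [← LinearMap.ker_eq_bot, LinearMap.ker_eq_bot']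
  rintro ⟨b, θ⟩ h
  have h1 := congrFun (congrFun h i)
  have h2 := congrFun (congrFun h j)
  simp only [trivialMotion_apply, quarterTurn, Fin.forall_fin_two] at h1 h2
  simp at h1 h2
  have hθ : θ = 0 := by
    by_contra hθ
    apply hij
    have e0 : θ * (x i 0 - x j 0) = 0 := by linarith
    have e1 : θ * (x i 1 - x j 1) = 0 := by linarith
    ext a
    fin_cases a
    · simpa [hθ, sub_eq_zero] using e0
    · simpa [hθ, sub_eq_zero] using e1
  subst hθ
  ext a
  · fin_cases a
    · simpa using h1.1
    · simpa using h1.2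
  · rfl

theorem mulVec_dotProduct_mulVec {Q : Matrix (Fin 2) (Fin 2) ℝ}
    (hQ : Q ∈ Matrix.specialOrthogonalGroup (Fin 2) ℝ) (u v : Fin 2 → ℝ) :
    (Q *ᵥ u) ⬝ᵥ (Q *ᵥ v) = u ⬝ᵥ v := by
  have h : Qᵀ * Q = 1 := (Matrix.mem_orthogonalGroup_iff' _ _).1
    (Matrix.mem_specialOrthogonalGroup_iff.1 hQ).1
  rw [Matrix.dotProduct_mulVec, Matrix.vecMul_mulVec, ← Matrix.mulVec_transpose,
    Matrix.transpose_mul, Matrix.transpose_transpose, h, Matrix.one_mulVec]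

/-! ### Rigidity matrices and their ranks. -/

namespace OrientedLabelling

variable {n m : ℕ} {G : SimpleGraph (Fin n)} (E : OrientedLabelling G m)

theorem head_ne_tail (k : Fin m) : E.head k ≠ E.tail k :=
  (SimpleGraph.mem_edgeSet G).1 (E.bijOn.mapsTo (Set.mem_univ k)) |>.ne

theorem sum_H_mul (k : Fin m) (f : Fin n → ℝ) :
    ∑ i, E.H k i * f i = f (E.head k) - f (E.tail k) := by
  have h : ∀ i, E.H k i * f i =
      (if E.head k = i then f i else 0) - if E.tail k = i then f i else 0 := by
    intro i
    unfold H
    by_cases h1 : E.head k = i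
    · have h2 : E.tail k ≠ i := fun h => E.head_ne_tail k (h1.trans h.symm)
      simp [h1, h2]
    · by_cases h2 : E.tail k = i <;> simp [h1, h2]
  simp [h, Finset.sum_sub_distrib]

theorem max_neg_H (k : Fin m) (i : Fin n) :
    max (-E.H k i) 0 = if E.tail k = i then 1 else 0 := by
  unfold H
  by_cases h1 : E.head k = i
  · have h2 : E.tail k ≠ i := fun h => E.head_ne_tail k (h1.trans h.symm)
    simp [h1, h2]
  · by_cases h2 : E.tail k = i <;> simp [h1, h2]

/-- A multi-point as a vector with `2n` entries. -/
def flat (v : MultiPoint n) : Fin n × Fin 2 → ℝ := fun c => v c.1 c.2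

theorem R_mulVec (x v : MultiPoint n) (k : Fin m) :
    (E.R x *ᵥ flat v) k = E.z x k ⬝ᵥ E.z v k := by
  have h := E.sum_H_mul k (fun i => E.z x k ⬝ᵥ v i)
  rw [← dotProduct_sub] at h
  change _ = E.z x k ⬝ᵥ (v (E.head k) - v (E.tail k))
  rw [← h]
  simp only [Matrix.mulVec, dotProduct, R, Matrix.of_apply, flat, Fintype.sum_prod_type,
    Finset.mul_sum, mul_assoc]

theorem Rred_mulVec (T : Finset (Fin m)) (x v : MultiPoint n) (k : T) :
    (E.Rred T x *ᵥ flat v) k = E.z x k ⬝ᵥ E.z v k := E.R_mulVec x v k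

/-- The positions enter only through inner products of the `z_k`. This gives the invariance of the
error system under plane motions. -/
theorem Rred_gram (T : Finset (Fin m)) (x : MultiPoint n) (k l : T) :
    (E.Rred T x * (E.Rred T x)ᵀ) k l = (∑ i, E.H k i * E.H l i) * (E.z x k ⬝ᵥ E.z x l) := by
  simp only [Matrix.mul_apply, Matrix.transpose_apply, Rred, R, Matrix.of_apply,
    Fintype.sum_prod_type, dotProduct, Finset.sum_mul_sum]
  exact Finset.sum_congr rfl fun i _ => Finset.sum_congr rfl fun a _ => by ring

theorem Rred_mul_S (T : Finset (Fin m)) (x : MultiPoint n) (k : T) (l : Fin m) :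
    (E.Rred T x * (E.S x)ᵀ) k l =
      (∑ i, E.H k i * max (-E.H l i) 0) * (E.z x k ⬝ᵥ E.z x l) := by
  simp only [Matrix.mul_apply, Matrix.transpose_apply, Rred, R, S, Matrix.of_apply,
    Fintype.sum_prod_type, dotProduct, Finset.sum_mul_sum]
  exact Finset.sum_congr rfl fun i _ => Finset.sum_congr rfl fun a _ => by ring

theorem rank_Rred_eq (T : Finset (Fin m)) (x : MultiPoint n) :
    (E.Rred T x).rank = Module.finrank ℝ (Submodule.span ℝ ((E.R x).row '' (T : Set (Fin m)))) := by
  have h : Set.range (E.Rred T x).row = (E.R x).row '' (T : Set (Fin m)) := ?_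
  · rw [Matrix.rank_eq_finrank_span_row, h]
  ext v
  constructor
  · rintro ⟨k, rfl⟩
    exact ⟨k, k.2, rfl⟩
  · rintro ⟨k, hk, rfl⟩
    exact ⟨⟨k, hk⟩, rfl⟩

theorem rank_Rred_le (T : Finset (Fin m)) (x : MultiPoint n) : (E.Rred T x).rank ≤ T.card := by
  simpa using (E.Rred T x).rank_le_card_height

theorem exists_minInfRigidOn {x : MultiPoint n} (h : E.InfRigid x) :
    ∃ T : Finset (Fin m), E.MinInfRigidOn T x := by
  classical
  have hu : E.InfRigidOn Finset.univ x := by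
    have h' : (E.R x).rank = 2 * n - 3 := h
    rw [InfRigidOn, rank_Rred_eq, ← h', Matrix.rank_eq_finrank_span_row, Finset.coe_univ,
      Set.image_univ]
  obtain ⟨T, hT, hmin⟩ := (Finset.univ.filter fun T : Finset (Fin m) => E.InfRigidOn T x).exists_min_image
    Finset.card ⟨_, by simpa using hu⟩
  refine ⟨T, by simpa using hT, fun k hk hr => ?_⟩
  have := hmin (T.erase k) (by simpa using hr)
  have := Finset.card_erase_lt_of_mem hk
  omega

/-- A row in the span of the others could be dropped without loss of rank, so minimality makes the
rows independent and their number equals the rank. -/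
theorem MinInfRigidOn.card_eq {E : OrientedLabelling G m} {T : Finset (Fin m)} {x : MultiPoint n} (h : E.MinInfRigidOn T x) :
    T.card = 2 * n - 3 := by
  have hind : LinearIndependent ℝ (fun k : T => (E.R x).row k) := by
    rw [linearIndependent_iff_notMem_span]
    intro k hk
    refine h.2 k k.2 ?_
    rw [InfRigidOn, rank_Rred_eq]
    have h1 := h.1
    rw [InfRigidOn, rank_Rred_eq] at h1
    have hset : (E.R x).row '' (T : Set (Fin m)) =
        insert ((E.R x).row k) ((E.R x).row '' ((T.erase k : Finset _) : Set (Fin m))) := by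
      rw [← Set.image_insert_eq, ← Finset.coe_insert, Finset.insert_erase k.2]
    have hk' : (E.R x).row k ∈ Submodule.span ℝ ((E.R x).row '' ((T.erase k : Finset _) : Set (Fin m))) := by
      refine Submodule.span_mono ?_ hk
      rintro _ ⟨l, hl, rfl⟩
      refine ⟨l, ?_, rfl⟩
      exact Finset.mem_coe.2 (Finset.mem_erase.2 ⟨fun h => hl.2 (Subtype.ext h), l.2⟩)
    rw [← h1, hset, Submodule.span_insert_eq_span hk']
  have h1 : (E.Rred T x).rank = _ := h.1
  rw [← h1, Matrix.rank_eq_finrank_span_row]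
  have := (linearIndependent_iff_card_eq_finrank_span.1 hind)
  rw [Fintype.card_coe] at this
  exact this

theorem minInfRigidOn_iff (hn : 3 ≤ n) {T : Finset (Fin m)} (hT : T.card = 2 * n - 3) (x : MultiPoint n) :
    E.MinInfRigidOn T x ↔ E.InfRigidOn T x := by
  refine ⟨fun h => h.1, fun h => ⟨h, fun k hk hr => ?_⟩⟩
  have h1 : (E.Rred (T.erase k) x).rank = _ := hr
  have h2 := E.rank_Rred_le (T.erase k) x
  rw [Finset.card_erase_of_mem hk] at h2
  omega

/-- With exactly `2n - 3` rows, rigidity is full row rank. In determinant form it is visibly an open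
condition, invariant under plane motions. -/
theorem infRigidOn_iff_det {T : Finset (Fin m)} (hT : T.card = 2 * n - 3) (x : MultiPoint n) :
    E.InfRigidOn T x ↔ (E.Rred T x * (E.Rred T x)ᵀ).det ≠ 0 := by
  rw [InfRigidOn, ← Matrix.rank_self_mul_transpose, ← hT, ← Fintype.card_coe T]
  rw [← isUnit_iff_ne_zero, ← Matrix.isUnit_iff_isUnit_det]
  refine ⟨fun h => ?_, fun h => Matrix.rank_of_isUnit _ h⟩
  rw [← Matrix.linearIndependent_rows_iff_isUnit, linearIndependent_iff_card_eq_finrank_span,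
    Set.finrank, ← Matrix.rank_eq_finrank_span_row, h]

theorem exists_ne_of_infRigidOn (hn : 3 ≤ n) {T : Finset (Fin m)} {x : MultiPoint n}
    (h : E.InfRigidOn T x) : ∃ i j, x i ≠ x j := by
  by_contra! hx
  have h0 : E.Rred T x = 0 := by
    ext k c
    simp [Rred, R, z, hx (E.head k) (E.tail k)]
  rw [InfRigidOn, h0, Matrix.rank_zero] at h
  omega

/-- At an infinitesimally rigid formation only the trivial motions preserve the edge lengths to
first order. -/
theorem exists_trivialMotion (hn : 3 ≤ n) {T : Finset (Fin m)} {x : MultiPoint n}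
    (h : E.InfRigidOn T x) {v : MultiPoint n} (hv : ∀ k ∈ T, E.z x k ⬝ᵥ E.z v k = 0) :
    ∃ b θ, v = trivialMotion x (b, θ) := by
  let e : MultiPoint n ≃ₗ[ℝ] (Fin n × Fin 2 → ℝ) := (LinearEquiv.curry ℝ ℝ (Fin n) (Fin 2)).symm
  have he : ∀ v, e v = flat v := fun v => rfl
  let K : Submodule ℝ (MultiPoint n) :=
    LinearMap.ker ((E.Rred T x).mulVecLin ∘ₗ (e : MultiPoint n →ₗ[ℝ] _))
  have hK : ∀ v, v ∈ K ↔ ∀ k ∈ T, E.z x k ⬝ᵥ E.z v k = 0 := by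
    intro v
    simp only [K, LinearMap.mem_ker, LinearMap.comp_apply, LinearEquiv.coe_coe, he,
      Matrix.mulVecLin_apply, funext_iff, Rred_mulVec]
    simp
  -- The kernel has dimension `2n - (2n - 3) = 3`, the dimension of the space of trivial motions it
  -- contains; so the two agree.
  have hdim : Module.finrank ℝ K = 3 := by
    have h1 := LinearMap.finrank_range_add_finrank_ker
      ((E.Rred T x).mulVecLin ∘ₗ (e : MultiPoint n →ₗ[ℝ] _))
    rw [LinearMap.range_comp_of_range_eq_top _ e.range] at h1
    have h2 : Module.finrank ℝ (LinearMap.range (E.Rred T x).mulVecLin) = 2 * n - 3 := h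
    have h3 : Module.finrank ℝ (MultiPoint n) = 2 * n := by
      rw [e.finrank_eq]; simp [mul_comm]
    rw [h2, h3] at h1
    change 2 * n - 3 + Module.finrank ℝ K = 2 * n at h1
    omega
  obtain ⟨i, j, hij⟩ := E.exists_ne_of_infRigidOn hn h
  have hle : LinearMap.range (trivialMotion x) ≤ K := by
    rintro _ ⟨⟨b, θ⟩, rfl⟩
    rw [hK]
    intro k _
    simp only [z, trivialMotion_apply, quarterTurn, Matrix.vec2_dotProduct]
    simp
    ring
  have heq := Submodule.eq_of_le_of_finrank_eq hle (by
    rw [LinearMap.finrank_range_of_inj (trivialMotion_injective hij), hdim]; simp)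
  obtain ⟨⟨b, θ⟩, hp⟩ := (heq ▸ (hK v).2 hv : v ∈ LinearMap.range (trivialMotion x))
  exact ⟨b, θ, hp.symm⟩

/-! ### Invariance under rotations and translations. -/

section Invariance

variable {Q : Matrix (Fin 2) (Fin 2) ℝ}

theorem z_moveBy (Q : Matrix (Fin 2) (Fin 2) ℝ) (b : Fin 2 → ℝ) (x : MultiPoint n) (k : Fin m) :
    E.z (moveBy Q b x) k = Q *ᵥ E.z x k := by
  simp [z, moveBy, Matrix.mulVec_sub]

theorem err_moveBy (hQ : Q ∈ Matrix.specialOrthogonalGroup (Fin 2) ℝ) (d : Fin m → ℝ)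
    (b : Fin 2 → ℝ) (x : MultiPoint n) : E.err d (moveBy Q b x) = E.err d x := by
  ext k
  simp only [err, z_moveBy, mulVec_dotProduct_mulVec hQ]

theorem field_moveBy (hQ : Q ∈ Matrix.specialOrthogonalGroup (Fin 2) ℝ) (d : Fin m → ℝ)
    (b : Fin 2 → ℝ) (x : MultiPoint n) (μ : Fin m → ℝ) (i : Fin n) :
    E.field d (moveBy Q b x) μ i = Q *ᵥ E.field d x μ i := by
  simp only [field, err_moveBy E hQ, z_moveBy, Matrix.mulVec_add, Matrix.mulVec_neg,
    Matrix.mulVec_sum, Matrix.mulVec_smul]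

theorem Rred_gram_moveBy (hQ : Q ∈ Matrix.specialOrthogonalGroup (Fin 2) ℝ)
    (T : Finset (Fin m)) (b : Fin 2 → ℝ) (x : MultiPoint n) :
    E.Rred T (moveBy Q b x) * (E.Rred T (moveBy Q b x))ᵀ = E.Rred T x * (E.Rred T x)ᵀ := by
  ext k l
  simp only [Rred_gram, z_moveBy, mulVec_dotProduct_mulVec hQ]

theorem Rred_mul_S_moveBy (hQ : Q ∈ Matrix.specialOrthogonalGroup (Fin 2) ℝ)
    (T : Finset (Fin m)) (b : Fin 2 → ℝ) (x : MultiPoint n) :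
    E.Rred T (moveBy Q b x) * (E.S (moveBy Q b x))ᵀ = E.Rred T x * (E.S x)ᵀ := by
  ext k l
  simp only [Rred_mul_S, z_moveBy, mulVec_dotProduct_mulVec hQ]

end Invariance

/-! ### The derivative of the error map. -/

section Derivative

/-- The derivative of the error map. -/
noncomputable def errDeriv (x : MultiPoint n) : MultiPoint n →L[ℝ] (Fin m → ℝ) :=
  LinearMap.toContinuousLinearMap
    { toFun := fun v k => 2 * (E.z x k ⬝ᵥ E.z v k)
      map_add' := fun u v => by
        ext k; simp only [z, Matrix.vec2_dotProduct, Pi.add_apply, Pi.sub_apply]; ring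
      map_smul' := fun c v => by
        ext k
        simp only [z, Matrix.vec2_dotProduct, Pi.smul_apply, Pi.sub_apply, smul_eq_mul,
          RingHom.id_apply]
        ring }

theorem errDeriv_apply (x v : MultiPoint n) (k : Fin m) :
    E.errDeriv x v k = 2 * (E.z x k ⬝ᵥ E.z v k) := rfl

theorem contDiff_err (d : Fin m → ℝ) {N : WithTop ℕ∞} : ContDiff ℝ N (E.err d) := by
  unfold err z
  simp only [Matrix.vec2_dotProduct, Pi.sub_apply]
  fun_prop

theorem hasFDerivAt_err (d : Fin m → ℝ) (x : MultiPoint n) :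
    HasFDerivAt (E.err d) (E.errDeriv x) x := by
  rw [hasFDerivAt_pi']
  intro k
  have hp : ∀ (i : Fin n) (a : Fin 2), HasFDerivAt (fun x : MultiPoint n => x i a)
      ((ContinuousLinearMap.proj (R := ℝ) (φ := fun _ : Fin 2 => ℝ) a).comp
        (ContinuousLinearMap.proj (R := ℝ) (φ := fun _ : Fin n => Fin 2 → ℝ) i)) x := fun i a =>
    ((ContinuousLinearMap.proj (R := ℝ) (φ := fun _ : Fin 2 => ℝ) a).comp
        (ContinuousLinearMap.proj (R := ℝ) (φ := fun _ : Fin n => Fin 2 → ℝ) i)).hasFDerivAt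
  have h0 := (hp (E.head k) 0).sub (hp (E.tail k) 0)
  have h1 := (hp (E.head k) 1).sub (hp (E.tail k) 1)
  have h := ((h0.mul h0).add (h1.mul h1)).sub_const (d k ^ 2)
  refine (h.congr_fderiv ?_).congr_of_eventuallyEq (Filter.Eventually.of_forall fun x => ?_)
  · ext v
    simp [errDeriv_apply, z, Matrix.vec2_dotProduct]
    ring
  · simp only [err, z, Matrix.vec2_dotProduct, Pi.sub_apply, Pi.add_apply, Pi.mul_apply]

end Derivative

end OrientedLabelling

/-! ### Rotations of the plane and positions relative to the centroid. -/

/-- The counterclockwise planeRotation of the plane by the angle `θ`. -/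
noncomputable def planeRotation (θ : ℝ) : Matrix (Fin 2) (Fin 2) ℝ :=
  !![Real.cos θ, -Real.sin θ; Real.sin θ, Real.cos θ]

theorem planeRotation_mem (θ : ℝ) : planeRotation θ ∈ Matrix.specialOrthogonalGroup (Fin 2) ℝ := by
  rw [planeRotation, Matrix.of_mem_specialOrthogonalGroup_fin_two_iff]
  refine ⟨rfl, by simp, ?_⟩
  rw [neg_sq, Real.cos_sq_add_sin_sq]

theorem planeRotation_mulVec (θ : ℝ) (v : Fin 2 → ℝ) :
    planeRotation θ *ᵥ v = Real.cos θ • v + Real.sin θ • quarterTurn v := by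
  ext a
  fin_cases a <;> simp [planeRotation, quarterTurn, Matrix.mulVec, dotProduct, Fin.sum_univ_two]
  ring

theorem planeRotation_zero : planeRotation 0 = 1 := by
  simp [planeRotation, Matrix.one_fin_two]

theorem hasDerivAt_planeRotation_mulVec (w t : ℝ) (v : Fin 2 → ℝ) :
    HasDerivAt (fun t => planeRotation (w * t) *ᵥ v) (planeRotation (w * t) *ᵥ (w • quarterTurn v)) t := by
  have h : HasDerivAt (fun t => w * t) w t := by simpa using (hasDerivAt_id t).const_mul w
  have h1 := (h.cos.smul_const v).add (h.sin.smul_const (quarterTurn v))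
  simp only [planeRotation_mulVec]
  refine h1.congr_deriv ?_
  ext a
  fin_cases a <;> simp [quarterTurn] <;> ring

theorem continuous_planeRotation_mulVec (w : ℝ) (v : Fin 2 → ℝ) :
    Continuous fun t => planeRotation (w * t) *ᵥ v := by
  simp only [planeRotation_mulVec]
  fun_prop

/-- `n` times the position of the `i`-th point relative to the centroid. -/
def centered {n : ℕ} (x : MultiPoint n) (i : Fin n) : Fin 2 → ℝ := ∑ a, (x i - x a)

theorem centered_eq {n : ℕ} (x : MultiPoint n) (i : Fin n) (c : Fin 2) :
    centered x i c = n * x i c - ∑ a, x a c := by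
  simp [centered]

theorem sum_centered {n : ℕ} (x : MultiPoint n) (c : Fin 2) : ∑ i, centered x i c = 0 := by
  simp [centered_eq, ← Finset.mul_sum]

theorem exists_centered_ne_zero {n : ℕ} (hn : 3 ≤ n) {x : MultiPoint n} {i j : Fin n}
    (hij : x i ≠ x j) : ∃ a, centered x a ≠ 0 := by
  by_contra! h
  apply hij
  ext c
  have h1 := congrFun (h i) c
  have h2 := congrFun (h j) c
  simp only [centered_eq, Pi.zero_apply] at h1 h2
  have hn' : (n : ℝ) ≠ 0 := by positivity
  exact mul_left_cancel₀ hn' (by linarith)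

/-! ### Torques about the centroid. -/

namespace OrientedLabelling

variable {n m : ℕ} {G : SimpleGraph (Fin n)} (E : OrientedLabelling G m)

/-- The torque about the centroid exerted by a unit mismatch on edge `k`, times `n`. -/
def torque (x : MultiPoint n) (k : Fin m) : ℝ := wedge (centered x (E.tail k)) (E.z x k)

/-- The centered positions of head and tail differ by `n z_k`, which the wedge with `z_k` kills. -/
theorem wedge_centered_head (x : MultiPoint n) (k : Fin m) :
    wedge (centered x (E.head k)) (E.z x k) = E.torque x k := by
  simp only [torque, wedge, centered_eq, z, Pi.sub_apply]
  ring

/-- In an infinitesimally rigid formation some edge does not point at the centroid. -/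
theorem exists_torque_ne_zero (hn : 3 ≤ n) {T : Finset (Fin m)} {x : MultiPoint n}
    (h : E.InfRigidOn T x) : ∃ k, E.torque x k ≠ 0 := by
  by_contra! h0
  have key : ∀ i, centered x i ≠ 0 → ∀ a b, a ≠ i → b ≠ i → x a = x b := by
    intro i hi a b ha hb
    -- Without torques every edge at `i` is parallel to `centered x i`, so displacing `i` alone,
    -- perpendicularly to that vector, preserves all lengths to first order.
    have hv : ∀ k ∈ T, E.z x k ⬝ᵥ E.z (Pi.single i (quarterTurn (centered x i)) : MultiPoint n) k = 0 := by
      intro k _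
      have h1 := h0 k
      have h2 := E.wedge_centered_head x k
      rw [h1] at h2
      rw [torque] at h1
      simp only [wedge] at h1 h2
      by_cases hh : E.head k = i
      · have ht : E.tail k ≠ i := fun ht => E.head_ne_tail k (hh.trans ht.symm)
        subst hh
        have hz : E.z (Pi.single (E.head k) (quarterTurn (centered x (E.head k))) : MultiPoint n) k =
            quarterTurn (centered x (E.head k)) := by
          rw [z, Pi.single_eq_same, Pi.single_eq_of_ne ht, sub_zero]
        rw [hz, Matrix.vec2_dotProduct]
        simp only [quarterTurn, Matrix.cons_val_zero, Matrix.cons_val_one]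
        linarith
      · by_cases ht : E.tail k = i
        · subst ht
          have hz : E.z (Pi.single (E.tail k) (quarterTurn (centered x (E.tail k))) : MultiPoint n) k =
              -quarterTurn (centered x (E.tail k)) := by
            rw [z, Pi.single_eq_same, Pi.single_eq_of_ne hh, zero_sub]
          rw [hz, Matrix.vec2_dotProduct]
          simp only [quarterTurn, Pi.neg_apply, Matrix.cons_val_zero, Matrix.cons_val_one]
          linarith
        · simp [z, hh, ht]
    obtain ⟨p, θ, hp⟩ := E.exists_trivialMotion hn h hv
    -- This trivial motion vanishes at all points but `i`. It is not zero, hence a rotation, and all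
    -- those points coincide with its centre.
    have e : ∀ j, j ≠ i → p + θ • quarterTurn (x j) = 0 := by
      intro j hj
      rw [← trivialMotion_apply, ← hp, Pi.single_eq_of_ne hj]
    have hθ : θ ≠ 0 := by
      rintro rfl
      have e1 := e a ha
      have e2 := congrFun hp i
      rw [zero_smul, add_zero] at e1
      rw [trivialMotion_apply, zero_smul, add_zero, Pi.single_eq_same, e1] at e2
      apply hi
      have f0 := congrFun e2 0
      have f1 := congrFun e2 1
      simp [quarterTurn] at f0 f1
      ext c
      fin_cases c
      · exact f1
      · exact f0
    have e1 := (e a ha).trans (e b hb).symm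
    have e2 := smul_right_injective _ hθ (add_left_cancel e1)
    have f0 := congrFun e2 0
    have f1 := congrFun e2 1
    simp [quarterTurn] at f0 f1
    ext c
    fin_cases c
    · exact f1
    · exact f0
  obtain ⟨p, q, hpq⟩ := E.exists_ne_of_infRigidOn hn h
  obtain ⟨i, hi⟩ := exists_centered_ne_zero hn hpq
  obtain ⟨j, hj⟩ : ∃ j, j ∉ ({i} : Finset (Fin n)) := by
    by_contra! hc
    have := Finset.card_le_card (fun a _ => hc a : Finset.univ ⊆ ({i} : Finset (Fin n)))
    simp at this
    omega
  obtain ⟨k, hk⟩ : ∃ k, k ∉ ({i, j} : Finset (Fin n)) := by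
    by_contra! hc
    have := (Finset.card_le_card (fun a _ => hc a : Finset.univ ⊆ ({i, j} : Finset (Fin n)))).trans
      Finset.card_le_two
    simp at this
    omega
  simp only [Finset.mem_singleton, Finset.mem_insert, not_or] at hj hk
  -- All points but `i` coincide. Either `j` is the centroid, which forces `x i = x j`, or `key`
  -- applies at `j` and a third point `k` links the two.
  have hij : x i = x j := by
    by_cases hcj : centered x j = 0
    · have h1 : centered x j = x j - x i := by
        rw [centered, Finset.sum_eq_single i]
        · intro a _ ha
          rw [key i hi j a hj ha, sub_self]
        · simp
      rw [hcj] at h1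
      exact (sub_eq_zero.1 h1.symm).symm
    · rw [key j hcj i k (Ne.symm hj) hk.2, key i hi k j hk.1 hj]
  have hall : ∀ a, x a = x j := fun a => by
    by_cases ha : a = i
    · rw [ha, hij]
    · exact key i hi a j ha hj
  exact hi (by simp [centered, hall])

theorem field_apply (d : Fin m → ℝ) (x : MultiPoint n) (μ : Fin m → ℝ) (i : Fin n) (a : Fin 2) :
    E.field d x μ i a = -(∑ k, E.H k i * (E.err d x k * E.z x k a)) +
      ∑ k, max (-E.H k i) 0 * (μ k * E.z x k a) := by
  have h : ∀ k, E.H k i = (if E.head k = i then 1 else 0) - if E.tail k = i then 1 else 0 := by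
    intro k
    unfold H
    by_cases h1 : E.head k = i
    · have h2 : E.tail k ≠ i := fun h => E.head_ne_tail k (h1.trans h.symm)
      simp [h1, h2]
    · by_cases h2 : E.tail k = i <;> simp [h1, h2]
  simp only [max_neg_H]
  simp only [field, Pi.add_apply, Pi.neg_apply, Finset.sum_apply,
    Finset.sum_filter, ← Finset.sum_neg_distrib, ← Finset.sum_add_distrib, h]
  refine Finset.sum_congr rfl fun k _ => ?_
  split_ifs <;> simp <;> ring

/-- The error forces on an edge are opposite and have the same moment arm at both ends, so they
cancel; a mismatch acts only at the tail. -/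
theorem sum_wedge_field (d : Fin m → ℝ) (x : MultiPoint n) (μ : Fin m → ℝ) :
    ∑ i, wedge (centered x i) (E.field d x μ i) = ∑ k, μ k * E.torque x k := by
  have h : ∀ i, wedge (centered x i) (E.field d x μ i) =
      -(∑ k, E.H k i * (E.err d x k * wedge (centered x i) (E.z x k))) +
      ∑ k, max (-E.H k i) 0 * (μ k * wedge (centered x i) (E.z x k)) := by
    intro i
    simp only [wedge, field_apply, mul_add, mul_neg, Finset.mul_sum, ← Finset.sum_neg_distrib,
      ← Finset.sum_add_distrib, ← Finset.sum_sub_distrib]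
    exact Finset.sum_congr rfl fun k _ => by ring
  simp only [h, Finset.sum_add_distrib, Finset.sum_neg_distrib]
  rw [Finset.sum_comm]
  have h1 : ∀ k, ∑ i, E.H k i * (E.err d x k * wedge (centered x i) (E.z x k)) = 0 := by
    intro k
    rw [E.sum_H_mul k (fun i => E.err d x k * wedge (centered x i) (E.z x k)),
      wedge_centered_head, torque, sub_self]
  rw [Finset.sum_congr rfl fun k _ => h1 k, Finset.sum_comm]
  simp [max_neg_H, torque]

/-- Writing `n x_i` as its centered part plus `∑ a, x a` isolates terms linear in the centered
positions, which sum to zero; only the rotation about the centroid remains. -/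
theorem sum_wedge_trivialMotion (x : MultiPoint n) (b : Fin 2 → ℝ) (θ : ℝ) :
    n * ∑ i, wedge (centered x i) (trivialMotion x (b, θ) i) =
      θ * ∑ i, centered x i ⬝ᵥ centered x i := by
  have h : ∀ i, n * wedge (centered x i) (trivialMotion x (b, θ) i) =
      θ * (centered x i ⬝ᵥ centered x i) +
        (centered x i 0 * (n * b 1 + θ * ∑ a, x a 0) +
          centered x i 1 * (-(n * b 0) + θ * ∑ a, x a 1)) := by
    intro i
    simp only [wedge, trivialMotion_apply, quarterTurn, Matrix.vec2_dotProduct, Pi.add_apply,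
      Pi.smul_apply, smul_eq_mul, Matrix.cons_val_zero, Matrix.cons_val_one, centered_eq]
    ring
  rw [Finset.mul_sum, Finset.sum_congr rfl fun i _ => h i]
  simp only [Finset.sum_add_distrib, ← Finset.sum_mul, ← Finset.mul_sum, sum_centered]
  ring

/-- The angular velocity of a rigidly moving formation vanishes exactly when the mismatches exert
no total torque. -/
theorem sum_torque_eq_zero_iff (hn : 3 ≤ n) {T : Finset (Fin m)} {x : MultiPoint n}
    (h : E.InfRigidOn T x) {d μ : Fin m → ℝ} {b : Fin 2 → ℝ} {θ : ℝ}
    (hf : E.field d x μ = trivialMotion x (b, θ)) :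
    ∑ k, μ k * E.torque x k = 0 ↔ θ = 0 := by
  have h1 := sum_wedge_trivialMotion x b θ
  rw [← hf, sum_wedge_field] at h1
  obtain ⟨i, j, hij⟩ := E.exists_ne_of_infRigidOn hn h
  obtain ⟨a, ha⟩ := exists_centered_ne_zero hn hij
  have hpos : ∑ i, centered x i ⬝ᵥ centered x i ≠ 0 := by
    intro h0
    rw [Finset.sum_eq_zero_iff_of_nonneg
      (fun i _ => by rw [Matrix.vec2_dotProduct]; nlinarith [sq_nonneg (centered x i 0), sq_nonneg (centered x i 1)])] at h0
    exact ha (dotProduct_self_eq_zero.1 (h0 a (Finset.mem_univ a)))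
  have hn' : (n : ℝ) ≠ 0 := by positivity
  constructor
  · intro h0
    rw [h0, mul_zero] at h1
    exact (mul_eq_zero.1 h1.symm).resolve_right hpos
  · rintro rfl
    rw [zero_mul] at h1
    exact (mul_eq_zero.1 h1).resolve_left hn'

/-! ### The error system as the derivative of the reduced error. -/

section Reduced

variable (d : Fin m → ℝ) (T : Finset (Fin m))

/-- The derivative of the reduced error map. -/
noncomputable def redErrDeriv (x : MultiPoint n) : MultiPoint n →L[ℝ] (T → ℝ) :=
  ContinuousLinearMap.pi fun k => (ContinuousLinearMap.proj k.1).comp (E.errDeriv x)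

theorem redErrDeriv_apply (x v : MultiPoint n) (k : T) :
    E.redErrDeriv T x v k = 2 * (E.z x k ⬝ᵥ E.z v k) := rfl

theorem hasFDerivAt_redErr (x : MultiPoint n) :
    HasFDerivAt (E.redErr d T) (E.redErrDeriv T x) x :=
  hasFDerivAt_pi.2 fun k => hasFDerivAt_pi'.1 (E.hasFDerivAt_err d x) k.1

theorem contDiff_redErr {N : WithTop ℕ∞} : ContDiff ℝ N (E.redErr d T) :=
  contDiff_pi.2 fun k => contDiff_pi.1 (E.contDiff_err d) k.1

theorem redErr_moveBy {Q : Matrix (Fin 2) (Fin 2) ℝ}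
    (hQ : Q ∈ Matrix.specialOrthogonalGroup (Fin 2) ℝ) (b : Fin 2 → ℝ) (x : MultiPoint n) :
    E.redErr d T (moveBy Q b x) = E.redErr d T x := by
  ext k
  simp only [redErr, E.err_moveBy hQ]

theorem flat_field (x : MultiPoint n) (μ : Fin m → ℝ) :
    flat (E.field d x μ) = -((E.Rred T x)ᵀ *ᵥ E.redErr d T x)
      - (E.Rred Tᶜ x)ᵀ *ᵥ E.hatErr d T x + (E.S x)ᵀ *ᵥ μ := by
  ext ⟨i, a⟩
  simp only [flat, field_apply, Pi.add_apply, Pi.sub_apply, Pi.neg_apply, Matrix.mulVec,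
    dotProduct, Matrix.transpose_apply, S, Rred, R, Matrix.of_apply, redErr, hatErr]
  have h := Finset.sum_add_sum_compl T (fun k => E.H k i * E.z x k a * E.err d x k)
  rw [← Finset.sum_coe_sort T, ← Finset.sum_coe_sort Tᶜ] at h
  have h' : ∑ k, E.H k i * (E.err d x k * E.z x k a) = ∑ k, E.H k i * E.z x k a * E.err d x k :=
    Finset.sum_congr rfl fun k _ => by ring
  rw [h', ← h]
  have h2 : ∑ k, max (-E.H k i) 0 * (μ k * E.z x k a) =
      ∑ k, max (-E.H k i) 0 * E.z x k a * μ k :=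
    Finset.sum_congr rfl fun k _ => by ring
  rw [h2]
  ring

variable {d T}

/-- The chain rule applied to `ê = ψ(ẽ)`, as the error map has derivative `2R`. -/
theorem Rred_compl_eq {A : Set (MultiPoint n)} {ψ : (T → ℝ) → (↥(Tᶜ) → ℝ)} {x : MultiPoint n}
    (hA : A ∈ nhds x) (hψ : DifferentiableAt ℝ ψ (E.redErr d T x))
    (heq : ∀ x ∈ A, E.hatErr d T x = ψ (E.redErr d T x)) :
    E.Rred Tᶜ x = jac ψ (E.redErr d T x) * E.Rred T x := by
  have h1 : HasFDerivAt (E.hatErr d T) (E.redErrDeriv Tᶜ x) x := E.hasFDerivAt_redErr d Tᶜ x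
  have h2 := hψ.hasFDerivAt.comp x (E.hasFDerivAt_redErr d T x)
  have h3 := h1.unique (h2.congr_of_eventuallyEq (Filter.mem_of_superset hA heq))
  ext k c
  have h4 := congrFun (DFunLike.congr_fun h3 (fun i a => (Pi.single c 1 : _ → ℝ) (i, a))) k
  have hl : ∀ (T' : Finset (Fin m)) (l : T'),
      E.redErrDeriv T' x (fun i a => (Pi.single c 1 : _ → ℝ) (i, a)) l = 2 * E.Rred T' x l c := by
    intro T' l
    rw [redErrDeriv_apply, ← Rred_mulVec]
    have : flat (fun i a => (Pi.single c 1 : Fin n × Fin 2 → ℝ) (i, a)) = Pi.single c 1 := rfl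
    rw [this, Matrix.mulVec_single_one]
    rfl
  rw [hl] at h4
  have h5 : fderiv ℝ ψ (E.redErr d T x) (E.redErrDeriv T x fun i a => (Pi.single c 1 : _ → ℝ) (i, a)) =
      jac ψ (E.redErr d T x) *ᵥ (fun l => 2 * E.Rred T x l c) := by
    rw [jac, LinearMap.toMatrix'_mulVec]
    exact congrArg _ (funext fun l => hl T l)
  rw [ContinuousLinearMap.comp_apply, h5] at h4
  have h6 : (jac ψ (E.redErr d T x) *ᵥ fun l => 2 * E.Rred T x l c) k =
      2 * (jac ψ (E.redErr d T x) * E.Rred T x) k c := by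
    simp only [Matrix.mulVec, dotProduct, Matrix.mul_apply, Finset.mul_sum]
    exact Finset.sum_congr rfl fun l _ => by ring
  rw [h6] at h4
  linarith

/-- Substituting `R̂ = F R̃` turns `R' e` into `R̃'(ẽ + F' ψ(ẽ))`, so the formula for `g` becomes `2
R̃ ẋ`. -/
theorem errorSystem_eq {A : Set (MultiPoint n)} {ψ : (T → ℝ) → (↥(Tᶜ) → ℝ)}
    {g : (T → ℝ) → (Fin m → ℝ) → (T → ℝ)} (hg : E.IsErrorSystem d T A ψ g)
    (hψ : E.IsDependency d T A ψ) {x : MultiPoint n} (hx : x ∈ A)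
    (hA : A ∈ nhds x) (him : E.redErr d T '' A ∈ nhds (E.redErr d T x)) (μ : Fin m → ℝ) :
    g (E.redErr d T x) μ = (2 : ℝ) • (E.Rred T x *ᵥ flat (E.field d x μ)) := by
  have hd : DifferentiableAt ℝ ψ (E.redErr d T x) :=
    (hψ.smooth.contDiffAt him).differentiableAt (by simp)
  have hR := E.Rred_compl_eq hA hd hψ.eq
  rw [hg.eq x hx, flat_field E d T, hR, Matrix.transpose_mul, hψ.eq x hx]
  simp only [Matrix.mulVec_add, Matrix.mulVec_sub, Matrix.mulVec_neg, Matrix.mulVec_mulVec,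
    smul_add, smul_sub, smul_neg, Matrix.mul_assoc]

theorem field_eq_trivialMotion (hn : 3 ≤ n) {A : Set (MultiPoint n)}
    {ψ : (T → ℝ) → (↥(Tᶜ) → ℝ)}
    {g : (T → ℝ) → (Fin m → ℝ) → (T → ℝ)} (hg : E.IsErrorSystem d T A ψ g)
    (hψ : E.IsDependency d T A ψ) {x : MultiPoint n} (hx : x ∈ A)
    (hA : A ∈ nhds x) (him : E.redErr d T '' A ∈ nhds (E.redErr d T x))
    (hr : E.InfRigidOn T x) {μ : Fin m → ℝ} (h0 : g (E.redErr d T x) μ = 0) :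
    ∃ b θ, E.field d x μ = trivialMotion x (b, θ) := by
  rw [E.errorSystem_eq hg hψ hx hA him, smul_eq_zero_iff_right two_ne_zero] at h0
  refine E.exists_trivialMotion hn hr fun k hk => ?_
  have := congrFun h0 ⟨k, hk⟩
  rwa [Rred_mulVec] at this

end Reduced

/-- If the velocity at `x₀` is that of an infinitesimal motion of the plane, then the formation
moves rigidly. -/
theorem exists_rigid_solution {d μ : Fin m → ℝ} {x₀ : MultiPoint n} {b : Fin 2 → ℝ} {θ : ℝ}
    (h : E.field d x₀ μ = trivialMotion x₀ (b, θ)) :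
    ∃ (Q : ℝ → Matrix (Fin 2) (Fin 2) ℝ) (c : ℝ → Fin 2 → ℝ),
      (∀ t, Q t ∈ Matrix.specialOrthogonalGroup (Fin 2) ℝ) ∧
      ∀ t, HasDerivAt (fun t => moveBy (Q t) (c t) x₀) (E.field d (moveBy (Q t) (c t) x₀) μ) t := by
  -- The field at a moved formation is the rotated initial field. The angular velocity thus stays
  -- `θ`, and the translation integrates the rotated `b`.
  refine ⟨fun t => planeRotation (θ * t), fun t => ∫ s in (0 : ℝ)..t, planeRotation (θ * s) *ᵥ b,
    fun t => planeRotation_mem _, fun t => ?_⟩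
  rw [hasDerivAt_pi]
  intro i
  rw [E.field_moveBy (planeRotation_mem _), h, trivialMotion_apply, Matrix.mulVec_add, add_comm]
  exact (hasDerivAt_planeRotation_mulVec θ t (x₀ i)).add
    ((continuous_planeRotation_mulVec θ b).deriv_integral _ 0 t ▸
      ((continuous_planeRotation_mulVec θ b).integral_hasStrictDerivAt 0 t).hasDerivAt.differentiableAt.hasDerivAt)

end OrientedLabelling

/-! ### Equilibrium-error solutions and the open dense set of mismatches. -/

namespace OrientedLabelling

variable {n m : ℕ} {G : SimpleGraph (Fin n)} (E : OrientedLabelling G m)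
  {d : Fin m → ℝ} {T : Finset (Fin m)}

theorem centered_dotProduct_z (x : MultiPoint n) (i : Fin n) (k : Fin m) :
    centered x i ⬝ᵥ E.z x k = ∑ a, (x i - x a) ⬝ᵥ (x (E.head k) - x (E.tail k)) := by
  rw [centered, sum_dotProduct]; rfl

theorem centered_dotProduct_centered (x : MultiPoint n) (i j : Fin n) :
    centered x i ⬝ᵥ centered x j = ∑ a, ∑ b, (x i - x a) ⬝ᵥ (x j - x b) := by
  simp only [centered, sum_dotProduct, dotProduct_sum]
  exact Finset.sum_comm

/-- On an ambient space the products of torques are smooth functions of the reduced error. -/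
theorem IsAmbient.exists_torque_mul_torque {E : OrientedLabelling G m} {y : MultiPoint n}
    {A : Set (MultiPoint n)} (hA : E.IsAmbient d T y A) :
    ∃ Γ : Fin m → Fin m → (T → ℝ) → ℝ,
      (∀ k l, ContDiffOn ℝ ∞ (Γ k l) (E.redErr d T '' A)) ∧
      ∀ x ∈ A, ∀ k l, E.torque x k * E.torque x l = Γ k l (E.redErr d T x) := by
  choose η hη heq using hA.inner
  -- The identity `(p ∧ u)(q ∧ v) = (p·q)(u·v) - (p·v)(q·u)`. A single torque changes sign under
  -- reflections and so is no function of inner products; a product of two is.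
  refine ⟨fun k l ε =>
    (∑ a, ∑ b, η (E.tail k) a (E.tail l) b ε) * η (E.head k) (E.tail k) (E.head l) (E.tail l) ε -
      (∑ a, η (E.tail k) a (E.head l) (E.tail l) ε) *
        ∑ a, η (E.tail l) a (E.head k) (E.tail k) ε, fun k l => ?_, fun x hx k l => ?_⟩
  · refine ContDiffOn.sub (ContDiffOn.mul ?_ (hη _ _ _ _)) (ContDiffOn.mul ?_ ?_)
    · exact ContDiffOn.sum fun a _ => ContDiffOn.sum fun b _ => hη _ _ _ _
    · exact ContDiffOn.sum fun a _ => hη _ _ _ _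
    · exact ContDiffOn.sum fun a _ => hη _ _ _ _
  · simp only [← heq _ _ _ _ x hx, ← centered_dotProduct_z, ← centered_dotProduct_centered]
    simp only [torque, wedge, Matrix.vec2_dotProduct, z]
    ring

section Setting

variable {E : OrientedLabelling G m} {y : MultiPoint n} {A : Set (MultiPoint n)} {ψ : (T → ℝ) → (↥(Tᶜ) → ℝ)}
  {g : (T → ℝ) → (Fin m → ℝ) → (T → ℝ)} {r : ℝ} {M : Set (Fin m → ℝ)}
  {eps : (Fin m → ℝ) → (T → ℝ)}

theorem isOpen_errBall (T : Finset (Fin m)) (r : ℝ) : IsOpen (errBall T r) :=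
  isOpen_lt (by fun_prop) continuous_const

theorem zero_mem_errBall (T : Finset (Fin m)) {r : ℝ} (hr : 0 < r) : 0 ∈ errBall T r := by
  simp [errBall]; positivity

theorem IsSetting.field_eq (hn : 3 ≤ n) (h : E.IsSetting d T y A ψ g r M eps)
    {μ : Fin m → ℝ} (hμ : μ ∈ M) {x : MultiPoint n} (hx : x ∈ E.ballPart d T A r)
    (he : E.redErr d T x = eps μ) : ∃ b θ, E.field d x μ = trivialMotion x (b, θ) := by
  refine E.field_eq_trivialMotion hn h.errorSystem h.dependency hx.1
    (h.ambient.isOpen.mem_nhds hx.1)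
    (Filter.mem_of_superset ((isOpen_errBall T r).mem_nhds hx.2) h.ball_subset)
    (h.ambient.minInfRigid x hx.1).1 ?_
  rw [he]
  exact h.equilibrium μ hμ

theorem IsEquilibriumSolution.redErr_eq {μ : Fin m → ℝ} {x : ℝ → MultiPoint n}
    (hx : E.IsEquilibriumSolution d T A ψ r eps μ x) {t : ℝ} (ht : 0 ≤ t) :
    E.redErr d T (x t) = eps μ := by
  ext k
  rw [redErr, hx.err_eq t ht, assemble, dif_pos k.2]

/-- Any formation in `A` with reduced error `ε_μ` moves rigidly; this preserves its errors, and the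
invariance of `A` keeps it there. -/
theorem IsSetting.exists_equilibriumSolution (hn : 3 ≤ n) (h : E.IsSetting d T y A ψ g r M eps)
    {μ : Fin m → ℝ} (hμ : μ ∈ M) (hB : eps μ ∈ errBall T r) :
    ∃ x, E.IsEquilibriumSolution d T A ψ r eps μ x := by
  obtain ⟨x₀, hx₀, he⟩ := h.ball_subset hB
  obtain ⟨b, θ, hf⟩ := h.field_eq hn hμ ⟨hx₀, he ▸ hB⟩ he
  obtain ⟨Q, c, hQ, hder⟩ := E.exists_rigid_solution hf
  refine ⟨fun t => moveBy (Q t) (c t) x₀, fun t _ => (hder t).hasDerivWithinAt,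
    fun t _ => ⟨h.ambient.invariant _ (hQ t) _ _ hx₀, ?_⟩, fun t _ => ?_⟩
  · rw [E.redErr_moveBy d T (hQ t), he]
    exact hB
  · rw [E.err_moveBy (hQ t)]
    ext k
    rw [assemble]
    split_ifs with hk
    · exact congrFun he ⟨k, hk⟩
    · have := h.dependency.eq x₀ hx₀
      rw [he] at this
      exact congrFun this ⟨k, Finset.mem_compl.2 hk⟩

theorem z_trivialMotion (E : OrientedLabelling G m) (x : MultiPoint n) (b : Fin 2 → ℝ) (θ : ℝ) (k : Fin m) :
    E.z (trivialMotion x (b, θ)) k = θ • quarterTurn (E.z x k) := by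
  ext a
  fin_cases a <;> simp [z, trivialMotion_apply, quarterTurn] <;> ring

theorem hasDerivWithinAt_z (E : OrientedLabelling G m) {x : ℝ → MultiPoint n} {v : MultiPoint n} {s : Set ℝ} {t : ℝ}
    (h : HasDerivWithinAt x v s t) : HasDerivWithinAt (fun t => E.z (x t)) (E.z v) s t := by
  rw [hasDerivWithinAt_pi] at h ⊢
  exact fun k => (h (E.head k)).sub (h (E.tail k))

/-- As `τ_l ≠ 0`, the number `q` vanishes exactly when the angular velocity does. If `q = 0` then `ż
= 0` at all times. Otherwise `ż_l` is already nonzero at time `0`, because `τ_l ≠ 0` forces `z_l ≠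
0`. -/
theorem IsSetting.nonconstantZ_iff (hn : 3 ≤ n) (h : E.IsSetting d T y A ψ g r M eps)
    {μ : Fin m → ℝ} (hμ : μ ∈ M) {x : ℝ → MultiPoint n}
    (hx : E.IsEquilibriumSolution d T A ψ r eps μ x)
    {l : Fin m} (hl : ∀ t, 0 ≤ t → E.torque (x t) l ≠ 0) {q : ℝ}
    (hq : ∀ t, 0 ≤ t → (∑ k, μ k * E.torque (x t) k) * E.torque (x t) l = q) :
    E.NonconstantZ x ↔ q ≠ 0 := by
  have hfield : ∀ t, 0 ≤ t → ∃ b θ, E.field d (x t) μ = trivialMotion (x t) (b, θ) :=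
    fun t ht => h.field_eq hn hμ (hx.mem t ht) (hx.redErr_eq ht)
  have hq0 : ∀ t, 0 ≤ t → ∀ b θ, E.field d (x t) μ = trivialMotion (x t) (b, θ) →
      (q = 0 ↔ θ = 0) := by
    intro t ht b θ hf
    rw [← E.sum_torque_eq_zero_iff hn (h.ambient.minInfRigid _ (hx.mem t ht).1).1 hf, ← hq t ht,
      mul_eq_zero, or_iff_left (hl t ht)]
  constructor
  · rintro ⟨s, t, hs, ht, hst⟩ h0
    have hz : ∀ t, 0 ≤ t → HasDerivWithinAt (fun t => E.z (x t)) 0 (Set.Ici 0) t := by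
      intro t ht
      obtain ⟨b, θ, hf⟩ := hfield t ht
      have := E.hasDerivWithinAt_z (hx.solution t ht)
      rw [hf, (hq0 t ht b θ hf).1 h0] at this
      convert this using 1
      ext k : 1
      rw [z_trivialMotion, zero_smul, Pi.zero_apply]
    have hconst : ∀ t, 0 ≤ t → E.z (x t) = E.z (x 0) := by
      intro t ht
      refine constant_of_has_deriv_right_zero (a := 0) (b := t) (f := fun t => E.z (x t))
        (fun u hu => ((hz u hu.1).continuousWithinAt).mono Set.Icc_subset_Ici_self)
        (fun u hu => (hz u hu.1).mono (Set.Ici_subset_Ici.2 hu.1)) t ⟨ht, le_rfl⟩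
    exact hst ((hconst s hs).trans (hconst t ht).symm)
  · intro h0
    by_contra hc
    simp only [NonconstantZ, not_exists, not_and, not_not] at hc
    obtain ⟨b, θ, hf⟩ := hfield 0 le_rfl
    have h1 := E.hasDerivWithinAt_z (hx.solution 0 le_rfl)
    have h2 : HasDerivWithinAt (fun t => E.z (x t)) 0 (Set.Ici 0) 0 :=
      (hasDerivWithinAt_const (0 : ℝ) (Set.Ici 0) (E.z (x 0))).congr
        (fun t ht => hc t 0 ht le_rfl) rfl
    have h3 := congrFun ((uniqueDiffOn_Ici (0 : ℝ) 0 Set.self_mem_Ici).eq_deriv _ h1 h2) l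
    rw [hf, z_trivialMotion, Pi.zero_apply, smul_eq_zero,
      or_iff_right (fun hθ => h0 ((hq0 0 le_rfl b θ hf).2 hθ))] at h3
    apply hl 0 le_rfl
    have f0 := congrFun h3 0
    have f1 := congrFun h3 1
    simp [quarterTurn] at f0 f1
    simp [torque, wedge, f0, f1]

/-- A function that is continuously differentiable near `0` and has a nonzero derivative there is
nonzero on an open dense part of a neighbourhood of `0`. -/
theorem exists_isOpen_dense_ne_zero {V : Type*} [NormedAddCommGroup V] [NormedSpace ℝ V]
    {q : V → ℝ} {p : V → Prop} (hq : ContDiffAt ℝ 1 q 0) {v : V}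
    (hv : fderiv ℝ q 0 v ≠ 0) (hp : ∀ᶠ μ in nhds 0, p μ) :
    ∃ U : Set V, IsOpen U ∧ 0 ∈ U ∧ (∀ μ ∈ U, p μ) ∧ IsOpen (U ∩ {μ | q μ ≠ 0}) ∧
      U ⊆ closure (U ∩ {μ | q μ ≠ 0}) := by
  have h1 : ContinuousAt (fun μ => fderiv ℝ q μ v) 0 :=
    ((hq.fderiv_right (m := 0) (by simp)).continuousAt).clm_apply continuousAt_const
  have h2 := hq.eventually (by simp)
  obtain ⟨U, hU, hUo, h0⟩ := eventually_nhds_iff.1 (hp.and (h2.and (h1.eventually_ne hv)))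
  refine ⟨U, hUo, h0, fun μ hμ => (hU μ hμ).1, ?_, fun μ hμ => ?_⟩
  · have hc : ContinuousOn q U := fun μ hμ => (hU μ hμ).2.1.continuousAt.continuousWithinAt
    exact hc.isOpen_inter_preimage hUo isOpen_compl_singleton
  -- Off the closure `q` vanishes near `μ`, hence so does its derivative, although the derivative
  -- along `v` is nonzero throughout `U`.
  · by_contra hc
    rw [mem_closure_iff_frequently, Filter.not_frequently] at hc
    have hz : q =ᶠ[nhds μ] fun _ => 0 := by
      filter_upwards [hc, hUo.mem_nhds hμ] with ν h3 h4
      by_contra h5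
      exact h3 ⟨h4, h5⟩
    apply (hU μ hμ).2.2
    rw [hz.fderiv_eq]
    simp

theorem IsSetting.exists_open_dense (hn : 3 ≤ n) (hy : E.IsTarget d y)
    (h : E.IsSetting d T y A ψ g r M eps) :
    ∃ M₀ V : Set (Fin m → ℝ),
      IsOpen M₀ ∧ 0 ∈ M₀ ∧ M₀ ⊆ M ∧ IsOpen V ∧ V ⊆ M₀ ∧ M₀ ⊆ closure V ∧
      ∀ μ ∈ M₀,
        (∃ x, E.IsEquilibriumSolution d T A ψ r eps μ x) ∧
        ∀ x, E.IsEquilibriumSolution d T A ψ r eps μ x → (E.NonconstantZ x ↔ μ ∈ V) := by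
  obtain ⟨Γ, hΓ, hΓeq⟩ := h.ambient.exists_torque_mul_torque
  obtain ⟨l, hl⟩ := E.exists_torque_ne_zero hn (h.ambient.minInfRigid y h.ambient.mem).1
  have hy0 : E.redErr d T y = eps 0 := by
    ext k
    simp [redErr, err, hy.realizes, h.eps_zero]
  have hM : M ∈ nhds 0 := h.isOpen.mem_nhds h.zero_mem
  have hc : ∀ k l, ContDiffAt ℝ 1 (fun μ => Γ k l (eps μ)) 0 := fun k l =>
    (((hΓ k l).comp h.eps_smooth h.eps_mem).contDiffAt hM).of_le (by exact_mod_cast le_top)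
  have hpos : 0 < Γ l l (eps 0) := by
    rw [← hy0, ← hΓeq y h.ambient.mem]
    exact mul_self_pos.2 hl
  -- The total torque of the mismatches times `τ_l`, expressed through the reduced error so as to
  -- depend on `μ` alone.
  let q : (Fin m → ℝ) → ℝ := fun μ => ∑ k, μ k * Γ k l (eps μ)
  have hq : ContDiffAt ℝ 1 q 0 :=
    ContDiffAt.sum fun k _ => (by fun_prop : ContDiffAt ℝ 1 (fun μ : Fin m → ℝ => μ k) 0).mul (hc k l)
  have hv : fderiv ℝ q 0 (Pi.single l 1) ≠ 0 := by
    have hd : HasFDerivAt q (∑ k, ((0 : Fin m → ℝ) k • fderiv ℝ (fun μ => Γ k l (eps μ)) 0 +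
        Γ k l (eps 0) • ContinuousLinearMap.proj (R := ℝ) (φ := fun _ : Fin m => ℝ) k)) 0 :=
      HasFDerivAt.fun_sum fun k _ => (hasFDerivAt_apply k _).mul
        ((hc k l).differentiableAt one_ne_zero).hasFDerivAt
    rw [hd.fderiv]
    simp [Pi.single_apply, hpos.ne']
  have hB : ∀ᶠ μ in nhds 0, eps μ ∈ errBall T r := by
    refine (h.eps_smooth.continuousOn.continuousAt hM).eventually_mem ?_
    rw [h.eps_zero]
    exact (isOpen_errBall T r).mem_nhds (zero_mem_errBall T h.radius_pos)
  have hMe : ∀ᶠ μ in nhds 0, μ ∈ M := hM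
  -- Keeping `Γ l l` positive on `U` ensures `τ_l ≠ 0` along every equilibrium-error solution.
  obtain ⟨U, hU, h0, hUp, hVo, hVd⟩ := exists_isOpen_dense_ne_zero hq hv
    (hB.and (hMe.and ((hc l l).continuousAt.eventually (lt_mem_nhds hpos))))
  refine ⟨U, _, hU, h0, fun μ hμ => (hUp μ hμ).2.1, hVo, Set.inter_subset_left, hVd,
    fun μ hμ => ⟨h.exists_equilibriumSolution hn (hUp μ hμ).2.1 (hUp μ hμ).1, fun x hx => ?_⟩⟩
  have hΓt : ∀ t, 0 ≤ t → ∀ k, E.torque (x t) k * E.torque (x t) l = Γ k l (eps μ) := by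
    intro t ht k
    rw [hΓeq _ (hx.mem t ht).1, hx.redErr_eq ht]
  rw [h.nonconstantZ_iff hn (hUp μ hμ).2.1 hx (l := l) (q := q μ)]
  · simp [hμ]
  · intro t ht h0
    have := (hUp μ hμ).2.2
    rw [← hΓt t ht, h0, mul_zero] at this
    exact this.ne rfl
  · intro t ht
    simp only [q, ← hΓt t ht, Finset.sum_mul, mul_assoc]

end Setting

end OrientedLabelling

/-! ### Existence of a setting: local sections and preliminaries on motions. -/

/-- An analytic map whose derivative at a point is surjective has an analytic local section. -/
theorem ContDiffAt.exists_local_section {X F : Type*} [NormedAddCommGroup X] [NormedSpace ℝ X]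
    [NormedAddCommGroup F] [NormedSpace ℝ F] [FiniteDimensional ℝ F] {f : X → F} {a : X}
    (hf : ContDiffAt ℝ ω f a) {f' : X →L[ℝ] F} (hf' : HasFDerivAt f f' a)
    (hs : Function.Surjective f') :
    ∃ σ : F → X, ContDiffAt ℝ ω σ (f a) ∧ σ (f a) = a ∧ ∀ᶠ ε in nhds (f a), f (σ ε) = ε := by
  have : CompleteSpace F := FiniteDimensional.complete ℝ F
  -- On the affine slice `a + L ξ` the derivative of `f` is the identity, so the inverse function
  -- theorem applies there.
  obtain ⟨L, hL⟩ := f'.exists_rightInverse_of_surjective (LinearMap.range_eq_top.2 hs)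
  have ha : a + L 0 = a := by simp
  have hc : ContDiffAt ℝ ω (fun ξ => f (a + L ξ)) 0 :=
    ContDiffAt.comp (g := f) (0 : F) (ha.symm ▸ hf) (contDiffAt_const.add L.contDiff.contDiffAt)
  have hd : HasFDerivAt (fun ξ => f (a + L ξ)) ((ContinuousLinearEquiv.refl ℝ F : F ≃L[ℝ] F) : F →L[ℝ] F) 0 := by
    have h1 : HasFDerivAt (fun ξ => a + L ξ) L 0 := L.hasFDerivAt.const_add a
    have h2 := HasFDerivAt.comp (g := f) (0 : F) (ha.symm ▸ hf') h1
    rw [hL] at h2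
    exact h2
  have hne : (ω : WithTop ℕ∞) ≠ 0 := by simp
  have h0 := hc.localInverse_apply_image hd hne
  have h1 := hc.to_localInverse hd hne
  have h2 := (hc.hasStrictFDerivAt' hd hne).eventually_right_inverse
  simp only [ha] at h0 h1 h2
  refine ⟨fun ε => a + L (hc.localInverse hd hne ε), ?_, ?_, h2⟩
  · exact contDiffAt_const.add (L.contDiff.contDiffAt.comp _ h1)
  · simp only [h0, ha]

/-- Used to extract a limit of rotations when taking closures inside the tube. -/
theorem isCompact_specialOrthogonalGroup :
    IsCompact {Q : Matrix (Fin 2) (Fin 2) ℝ | Q ∈ Matrix.specialOrthogonalGroup (Fin 2) ℝ} := by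
  have hK : IsCompact (Set.univ.pi fun _ : Fin 2 => Set.univ.pi fun _ : Fin 2 => Set.Icc (-1 : ℝ) 1) :=
    isCompact_univ_pi fun _ => isCompact_univ_pi fun _ => isCompact_Icc
  refine hK.of_isClosed_subset (s := Set.univ.pi fun _ : Fin 2 => Set.univ.pi fun _ : Fin 2 => Set.Icc (-1 : ℝ) 1) ?_ ?_
  · simp only [Matrix.mem_specialOrthogonalGroup_fin_two_iff]
    refine (isClosed_eq ?_ ?_).inter ((isClosed_eq ?_ ?_).inter (isClosed_eq ?_ ?_)) <;> fun_prop
  · intro Q hQ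
    have hQ' : Q ∈ Matrix.specialOrthogonalGroup (Fin 2) ℝ := hQ
    intro i _ j _
    have := entry_norm_bound_of_unitary (Matrix.mem_specialOrthogonalGroup_iff.1 hQ').1 i j
    rw [Real.norm_eq_abs, abs_le] at this
    exact this

theorem moveBy_moveBy {n : ℕ} (P Q : Matrix (Fin 2) (Fin 2) ℝ) (b c : Fin 2 → ℝ)
    (x : MultiPoint n) : moveBy P b (moveBy Q c x) = moveBy (P * Q) (P *ᵥ c + b) x := by
  ext i : 1
  simp only [moveBy, Matrix.mulVec_add, Matrix.mulVec_mulVec, add_assoc]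

theorem moveBy_one_zero {n : ℕ} (x : MultiPoint n) : moveBy 1 0 x = x := by
  ext i : 1
  simp [moveBy]

theorem continuous_moveBy {n : ℕ} :
    Continuous fun p : Matrix (Fin 2) (Fin 2) ℝ × (Fin 2 → ℝ) × MultiPoint n =>
      moveBy p.1 p.2.1 p.2.2 := by
  unfold moveBy
  fun_prop

/-- Rotation of all the points by a right angle, as a continuous linear map. -/
noncomputable def quarterTurnCLM (n : ℕ) : MultiPoint n →L[ℝ] MultiPoint n :=
  LinearMap.toContinuousLinearMap
    { toFun := fun x i => quarterTurn (x i)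
      map_add' := fun x y => by
        ext i a; fin_cases a <;> simp [quarterTurn]; ring
      map_smul' := fun c x => by ext i a; fin_cases a <;> simp [quarterTurn] }

/-- The multi-point all of whose points coincide, as a continuous linear map. -/
noncomputable def diagCLM (n : ℕ) : (Fin 2 → ℝ) →L[ℝ] MultiPoint n :=
  ContinuousLinearMap.pi fun _ => ContinuousLinearMap.id ℝ _

theorem trivialMotion_eq {n : ℕ} (x : MultiPoint n) (b : Fin 2 → ℝ) (θ : ℝ) :
    trivialMotion x (b, θ) = θ • quarterTurnCLM n x + diagCLM n b := by
  ext i : 1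
  rw [trivialMotion_apply, add_comm]
  rfl

theorem moveBy_planeRotation {n : ℕ} (θ : ℝ) (b : Fin 2 → ℝ) (x : MultiPoint n) :
    moveBy (planeRotation θ) b x =
      Real.cos θ • x + Real.sin θ • quarterTurnCLM n x + diagCLM n b := by
  ext i : 1
  rw [moveBy, planeRotation_mulVec]
  rfl

namespace OrientedLabelling

variable {n m : ℕ} {G : SimpleGraph (Fin n)} {E : OrientedLabelling G m}
  {d : Fin m → ℝ} {T : Finset (Fin m)}

theorem exists_errBall_subset {s : Set (T → ℝ)} (hs : s ∈ nhds 0) :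
    ∃ r, 0 < r ∧ errBall T r ⊆ s := by
  obtain ⟨r, hr, hrs⟩ := Metric.mem_nhds_iff.1 hs
  refine ⟨r, hr, fun ε hε => hrs ?_⟩
  rw [mem_ball_zero_iff, pi_norm_lt_iff hr]
  intro k
  have h1 : ε k ^ 2 ≤ ∑ k, ε k ^ 2 :=
    Finset.single_le_sum (f := fun k => ε k ^ 2) (fun _ _ => sq_nonneg _) (Finset.mem_univ k)
  exact abs_lt_of_sq_lt_sq (h1.trans_lt hε) hr.le

theorem redErrDeriv_surjective (E : OrientedLabelling G m) {x : MultiPoint n}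
    (h : (E.Rred T x * (E.Rred T x)ᵀ).det ≠ 0) : Function.Surjective (E.redErrDeriv T x) := by
  intro w
  -- The right inverse `R̃'(R̃ R̃')⁻¹`; the `1/2` offsets the factor in the derivative `2 R̃`.
  let u := (E.Rred T x)ᵀ *ᵥ ((E.Rred T x * (E.Rred T x)ᵀ)⁻¹ *ᵥ ((1 / 2 : ℝ) • w))
  have hu : E.Rred T x *ᵥ u = (1 / 2 : ℝ) • w := by
    simp only [u, Matrix.mulVec_mulVec]
    rw [← Matrix.mul_assoc, Matrix.mul_nonsing_inv _ (isUnit_iff_ne_zero.2 h), Matrix.one_mulVec]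
  refine ⟨fun i a => u (i, a), ?_⟩
  ext k
  rw [redErrDeriv_apply, ← Rred_mulVec]
  have : flat (fun i a => u (i, a)) = u := rfl
  rw [this, hu]
  simp

/-- `σ` is a smooth section of the reduced error map over `U`, with rigid values and through
`y`. -/
structure IsRigidSection (E : OrientedLabelling G m) (d : Fin m → ℝ) (T : Finset (Fin m))
    (y : MultiPoint n) (U : Set (T → ℝ)) (σ : (T → ℝ) → MultiPoint n) : Prop where
  isOpen : IsOpen U
  zero_mem : 0 ∈ U
  zero : σ 0 = y
  redErr : ∀ ε ∈ U, E.redErr d T (σ ε) = ε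
  contDiffAt : ∀ ε ∈ U, ContDiffAt ℝ ω σ ε
  rigid : ∀ ε ∈ U, E.InfRigidOn T (σ ε)

theorem contDiff_gram (E : OrientedLabelling G m) (T : Finset (Fin m)) (k l : T) :
    ContDiff ℝ ω fun x : MultiPoint n => (E.Rred T x * (E.Rred T x)ᵀ) k l := by
  simp only [Rred_gram, z, Matrix.vec2_dotProduct, Pi.sub_apply]
  fun_prop

theorem contDiff_Rred_mul_S (E : OrientedLabelling G m) (T : Finset (Fin m)) (k : T) (l : Fin m) :
    ContDiff ℝ ω fun x : MultiPoint n => (E.Rred T x * (E.S x)ᵀ) k l := by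
  simp only [Rred_mul_S, z, Matrix.vec2_dotProduct, Pi.sub_apply]
  fun_prop

theorem exists_isRigidSection {y : MultiPoint n} (hT : E.MinInfRigidOn T y)
    (hy : E.redErr d T y = 0) :
    ∃ r σ, 0 < r ∧ E.IsRigidSection d T y (errBall T r) σ := by
  have hdet := (E.infRigidOn_iff_det hT.card_eq y).1 hT.1
  obtain ⟨σ, h1, h2, h3⟩ := ContDiffAt.exists_local_section
    (E.contDiff_redErr d T).contDiffAt (E.hasFDerivAt_redErr d T y) (E.redErrDeriv_surjective hdet)
  rw [hy] at h1 h2 h3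
  have hc : ContinuousAt (fun ε => (E.Rred T (σ ε) * (E.Rred T (σ ε))ᵀ).det) 0 := by
    have : Continuous fun x : MultiPoint n => E.Rred T x * (E.Rred T x)ᵀ :=
      continuous_matrix fun k l => (E.contDiff_gram T k l).continuous
    exact ContinuousAt.comp (g := fun x => (E.Rred T x * (E.Rred T x)ᵀ).det) this.matrix_det.continuousAt h1.continuousAt
  have h4 := hc.eventually_ne (by rwa [h2])
  -- Analyticity at a point spreads to a neighbourhood. For smoothness of order `∞` at a point the
  -- neighbourhood could shrink with the order.
  have h5 := h1.eventually (by simp)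
  obtain ⟨r, hr, hU⟩ := exists_errBall_subset (h3.and (h4.and h5))
  exact ⟨r, σ, hr, isOpen_errBall T r, zero_mem_errBall T hr, h2, fun ε hε => (hU hε).1,
    fun ε hε => (hU hε).2.2, fun ε hε => (E.infRigidOn_iff_det hT.card_eq _).2 (hU hε).2.1⟩

/-- All the formations congruent to one of the section `σ` over `U`. -/
def tube (E : OrientedLabelling G m) (d : Fin m → ℝ) (T : Finset (Fin m))
    (U : Set (T → ℝ)) (σ : (T → ℝ) → MultiPoint n) : Set (MultiPoint n) :=
  {x | E.redErr d T x ∈ U ∧ ∃ Q ∈ Matrix.specialOrthogonalGroup (Fin 2) ℝ, ∃ b,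
    x = moveBy Q b (σ (E.redErr d T x))}

/-! ### The tube of formations congruent to the section. -/

section Tube

variable {y : MultiPoint n} {U : Set (T → ℝ)} {σ : (T → ℝ) → MultiPoint n}

theorem moveBy_mem_tube {Q : Matrix (Fin 2) (Fin 2) ℝ}
    (hQ : Q ∈ Matrix.specialOrthogonalGroup (Fin 2) ℝ) (b : Fin 2 → ℝ) {x : MultiPoint n}
    (hx : x ∈ E.tube d T U σ) : moveBy Q b x ∈ E.tube d T U σ := by
  obtain ⟨h, P, hP, c, hc⟩ := hx
  refine ⟨by rwa [E.redErr_moveBy d T hQ], Q * P, mul_mem hQ hP, Q *ᵥ c + b, ?_⟩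
  rw [E.redErr_moveBy d T hQ, ← moveBy_moveBy, ← hc]

theorem IsRigidSection.mem_tube (h : E.IsRigidSection d T y U σ) {ε : T → ℝ} (hε : ε ∈ U) :
    σ ε ∈ E.tube d T U σ := by
  refine ⟨by rwa [h.redErr ε hε], 1, one_mem _, 0, ?_⟩
  rw [h.redErr ε hε, moveBy_one_zero]

theorem IsRigidSection.image_tube (h : E.IsRigidSection d T y U σ) :
    E.redErr d T '' E.tube d T U σ = U := by
  ext ε
  constructor
  · rintro ⟨x, hx, rfl⟩
    exact hx.1
  · exact fun hε => ⟨σ ε, h.mem_tube hε, h.redErr ε hε⟩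

/-- The map `(θ, b, ε) ↦` rotated and translated `σ ε` is a submersion at `(0, 0, ε)`. Any `v` is
the sum of a vector tangent to the section with the same derivative of the reduced error and a
remainder preserving lengths to first order; by rigidity the remainder is a trivial motion. -/
theorem IsRigidSection.tube_mem_nhds (hn : 3 ≤ n) (h : E.IsRigidSection d T y U σ) {ε : T → ℝ}
    (hε : ε ∈ U) : E.tube d T U σ ∈ nhds (σ ε) := by
  let Ψ : ℝ × (Fin 2 → ℝ) × (T → ℝ) → MultiPoint n := fun p =>
    moveBy (planeRotation p.1) p.2.1 (σ p.2.2)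
  have hσ : HasStrictFDerivAt σ (fderiv ℝ σ ε) ε := (h.contDiffAt ε hε).hasStrictFDerivAt (by simp)
  have hsnd : HasStrictFDerivAt (fun p : ℝ × (Fin 2 → ℝ) × (T → ℝ) => p.2.2) _ (0, 0, ε) :=
    ((ContinuousLinearMap.snd ℝ (Fin 2 → ℝ) (T → ℝ)).comp
      (ContinuousLinearMap.snd ℝ ℝ ((Fin 2 → ℝ) × (T → ℝ)))).hasStrictFDerivAt
  have hmid : HasStrictFDerivAt (fun p : ℝ × (Fin 2 → ℝ) × (T → ℝ) => p.2.1) _ (0, 0, ε) :=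
    ((ContinuousLinearMap.fst ℝ (Fin 2 → ℝ) (T → ℝ)).comp
      (ContinuousLinearMap.snd ℝ ℝ ((Fin 2 → ℝ) × (T → ℝ)))).hasStrictFDerivAt
  have hfst : HasStrictFDerivAt (fun p : ℝ × (Fin 2 → ℝ) × (T → ℝ) => p.1) _ (0, 0, ε) :=
    (ContinuousLinearMap.fst ℝ ℝ ((Fin 2 → ℝ) × (T → ℝ))).hasStrictFDerivAt
  have hσ' := HasStrictFDerivAt.comp (g := σ) ((0, 0, ε) : ℝ × (Fin 2 → ℝ) × (T → ℝ)) hσ hsnd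
  have hcos := (Real.hasStrictDerivAt_cos 0).comp_hasStrictFDerivAt
    ((0, 0, ε) : ℝ × (Fin 2 → ℝ) × (T → ℝ)) hfst
  have hsin := (Real.hasStrictDerivAt_sin 0).comp_hasStrictFDerivAt
    ((0, 0, ε) : ℝ × (Fin 2 → ℝ) × (T → ℝ)) hfst
  have hq := (quarterTurnCLM n).hasStrictFDerivAt.comp _ hσ'
  have hd := (diagCLM n).hasStrictFDerivAt.comp _ hmid
  have hΨ := ((hcos.smul hσ').add (hsin.smul hq)).add hd
  have hfun : Ψ = fun p => Real.cos p.1 • σ p.2.2 + Real.sin p.1 • quarterTurnCLM n (σ p.2.2) +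
      diagCLM n p.2.1 := funext fun p => moveBy_planeRotation _ _ _
  have hid : (E.redErrDeriv T (σ ε)).comp (fderiv ℝ σ ε) = ContinuousLinearMap.id ℝ (T → ℝ) := by
    refine HasFDerivAt.unique ((E.hasFDerivAt_redErr d T (σ ε)).comp ε hσ.hasFDerivAt) ?_
    exact (hasFDerivAt_id ε).congr_of_eventuallyEq
      (Filter.mem_of_superset (h.isOpen.mem_nhds hε) fun ε hε => h.redErr ε hε)
  have hmap := hΨ.map_nhds_eq_of_surj (LinearMap.range_eq_top.2 fun v => by
    have hker : ∀ k ∈ T, E.z (σ ε) k ⬝ᵥ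
        E.z (v - fderiv ℝ σ ε (E.redErrDeriv T (σ ε) v)) k = 0 := by
      intro k hk
      have h1 : E.redErrDeriv T (σ ε) (v - fderiv ℝ σ ε (E.redErrDeriv T (σ ε) v)) = 0 := by
        rw [map_sub, sub_eq_zero]
        exact (DFunLike.congr_fun hid (E.redErrDeriv T (σ ε) v)).symm
      have h2 := congrFun h1 ⟨k, hk⟩
      rw [redErrDeriv_apply] at h2
      simpa using h2
    obtain ⟨b, θ, hb⟩ := E.exists_trivialMotion hn (h.rigid ε hε) hker
    refine ⟨(θ, b, E.redErrDeriv T (σ ε) v), ?_⟩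
    rw [trivialMotion_eq, sub_eq_iff_eq_add] at hb
    conv_rhs => rw [hb]
    simp only [ContinuousLinearMap.coe_coe, add_apply, smul_apply, ContinuousLinearMap.smulRight_apply,
      ContinuousLinearMap.comp_apply, ContinuousLinearMap.coe_fst', ContinuousLinearMap.coe_snd',
      Function.comp_apply, Real.cos_zero, Real.sin_zero]
    simp
    abel)
  have hΨ0 : Ψ (0, 0, ε) = σ ε := by
    simp only [Ψ]
    rw [planeRotation_zero, moveBy_one_zero]
  change Filter.map (fun p : ℝ × (Fin 2 → ℝ) × (T → ℝ) => Real.cos p.1 • σ p.2.2 +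
    Real.sin p.1 • quarterTurnCLM n (σ p.2.2) + diagCLM n p.2.1) (nhds (0, 0, ε)) =
      nhds (Real.cos (0, 0, ε).1 • σ (0, 0, ε).2.2 + Real.sin (0, 0, ε).1 • quarterTurnCLM n (σ (0, 0, ε).2.2) + diagCLM n (0, 0, ε).2.1) at hmap
  have hmap' : Filter.map Ψ (nhds (0, 0, ε)) = nhds (Ψ (0, 0, ε)) := by
    rw [hfun]; exact hmap
  rw [← hΨ0, ← hmap']
  have hU : ∀ᶠ p : ℝ × (Fin 2 → ℝ) × (T → ℝ) in nhds (0, 0, ε), p.2.2 ∈ U :=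
    hsnd.continuousAt.eventually_mem (h.isOpen.mem_nhds hε)
  exact hU.mono fun p hp => moveBy_mem_tube (planeRotation_mem _) _ (h.mem_tube hp)

/-- The inverse motion carries a point of the tube to the section, where `tube_mem_nhds` applies,
and the tube is invariant. -/
theorem IsRigidSection.isOpen_tube (hn : 3 ≤ n) (h : E.IsRigidSection d T y U σ) :
    IsOpen (E.tube d T U σ) := by
  rw [isOpen_iff_mem_nhds]
  intro x hx
  obtain ⟨hU, Q, hQ, b, hb⟩ := hx
  have hQ1 : Q * Qᵀ = 1 := (Matrix.mem_orthogonalGroup_iff _ _).1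
    (Matrix.mem_specialOrthogonalGroup_iff.1 hQ).1
  have hQ2 : Qᵀ * Q = 1 := (Matrix.mem_orthogonalGroup_iff' _ _).1
    (Matrix.mem_specialOrthogonalGroup_iff.1 hQ).1
  let φ : MultiPoint n → MultiPoint n := moveBy Qᵀ (-(Qᵀ *ᵥ b))
  have hφx : φ x = σ (E.redErr d T x) := by
    conv_lhs => rw [hb]
    simp only [φ]
    rw [moveBy_moveBy, hQ2, add_neg_cancel, moveBy_one_zero]
  have hφ : ∀ x, moveBy Q b (φ x) = x := fun x => by
    simp only [φ]
    rw [moveBy_moveBy, hQ1, Matrix.mulVec_neg, Matrix.mulVec_mulVec, hQ1, Matrix.one_mulVec,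
      neg_add_cancel, moveBy_one_zero]
  have hc : ContinuousAt φ x :=
    (continuous_moveBy.comp (by fun_prop : Continuous fun x : MultiPoint n =>
      (Qᵀ, -(Qᵀ *ᵥ b), x))).continuousAt
  have hmem := hc.preimage_mem_nhds (by rw [hφx]; exact h.tube_mem_nhds hn hU)
  filter_upwards [hmem] with x' hx'
  rw [← hφ x']
  exact moveBy_mem_tube hQ b hx'

/-- Along a convergent sequence the rotations subconverge by compactness, and the translations then
converge because the positions do. The gap `s < r` keeps the limit error inside the open ball. -/
theorem IsRigidSection.closure_ballPart_subset {r s : ℝ} (hs : 0 < s) (hsr : s < r)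
    (h : E.IsRigidSection d T y (errBall T r) σ) :
    closure (E.ballPart d T (E.tube d T (errBall T r) σ) s) ⊆ E.tube d T (errBall T r) σ := by
  intro x hx
  obtain ⟨u, hu, hux⟩ := mem_closure_iff_seq_limit.1 hx
  have hcont : Continuous (E.redErr d T) := (E.contDiff_redErr d T (N := 0)).continuous
  have hU : E.redErr d T x ∈ errBall T r := by
    have hle : ∑ k, E.redErr d T x k ^ 2 ≤ s ^ 2 :=
      le_of_tendsto (((by fun_prop : Continuous fun x => ∑ k, E.redErr d T x k ^ 2).tendsto x).comp hux)
        (Filter.Eventually.of_forall fun k => (hu k).2.le)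
    exact hle.trans_lt (by nlinarith)
  have : FirstCountableTopology (Matrix (Fin 2) (Fin 2) ℝ) :=
    inferInstanceAs (FirstCountableTopology (Fin 2 → Fin 2 → ℝ))
  choose hr Q hQ b hb using fun k => (hu k).1
  obtain ⟨Q₀, hQ₀, f, hf, hQf⟩ := isCompact_specialOrthogonalGroup.tendsto_subseq hQ
  have hσ : Filter.Tendsto (fun k => σ (E.redErr d T (u (f k)))) Filter.atTop
      (nhds (σ (E.redErr d T x))) :=
    (h.contDiffAt _ hU).continuousAt.tendsto.comp
      ((hcont.tendsto x).comp (hux.comp hf.tendsto_atTop))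
  refine ⟨hU, Q₀, hQ₀, ?_⟩
  by_cases hn : Nonempty (Fin n)
  · obtain ⟨i⟩ := hn
    refine ⟨x i - Q₀ *ᵥ σ (E.redErr d T x) i, ?_⟩
    have hu' : ∀ k, u (f k) i = Q (f k) *ᵥ σ (E.redErr d T (u (f k))) i + b (f k) := fun k =>
      congrFun (hb (f k)) i
    have hbt : Filter.Tendsto (fun k => b (f k)) Filter.atTop
        (nhds (x i - Q₀ *ᵥ σ (E.redErr d T x) i)) := by
      have h1 : Filter.Tendsto (fun k => u (f k) i) Filter.atTop (nhds (x i)) :=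
        ((continuous_apply i).tendsto x).comp (hux.comp hf.tendsto_atTop)
      have h2 : Filter.Tendsto (fun k => Q (f k) *ᵥ σ (E.redErr d T (u (f k))) i) Filter.atTop
          (nhds (Q₀ *ᵥ σ (E.redErr d T x) i)) :=
        ((by fun_prop : Continuous fun p : Matrix (Fin 2) (Fin 2) ℝ × MultiPoint n =>
          p.1 *ᵥ p.2 i).tendsto (Q₀, σ (E.redErr d T x))).comp (hQf.prodMk_nhds hσ)
      refine (h1.sub h2).congr fun k => ?_
      rw [hu' k, add_sub_cancel_left]
    refine tendsto_nhds_unique (hux.comp hf.tendsto_atTop) ?_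
    refine ((continuous_moveBy.tendsto (Q₀, _, _)).comp
      (hQf.prodMk_nhds (hbt.prodMk_nhds hσ))).congr fun k => ?_
    exact (hb (f k)).symm
  · exact ⟨0, funext fun i => (hn ⟨i⟩).elim⟩

end Tube

end OrientedLabelling

/-! ### Calculus of matrix-vector products. -/

section MulVec

variable {X ι κ : Type*} [NormedAddCommGroup X] [NormedSpace ℝ X] [Fintype κ]
  {B : X → Matrix ι κ ℝ} {u : X → κ → ℝ} {p : X}

theorem ContDiffAt.matrix_mulVec [Fintype ι] {N : WithTop ℕ∞} (hB : ∀ i j, ContDiffAt ℝ N (fun q => B q i j) p)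
    (hu : ContDiffAt ℝ N u p) : ContDiffAt ℝ N (fun q => B q *ᵥ u q) p := by
  rw [contDiffAt_pi] at hu ⊢
  intro i
  exact ContDiffAt.sum fun j _ => (hB i j).mul (hu j)

/-- The product rule for `B u` at a zero of `u`. -/
theorem HasFDerivAt.matrix_mulVec_of_eq_zero [Fintype ι] (hB : ∀ i j, DifferentiableAt ℝ (fun q => B q i j) p)
    {u' : X →L[ℝ] κ → ℝ} (hu : HasFDerivAt u u' p) (h0 : u p = 0) :
    HasFDerivAt (fun q => B q *ᵥ u q) ((LinearMap.toContinuousLinearMap (B p).mulVecLin).comp u') p := by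
  rw [hasFDerivAt_pi']
  intro i
  have h := HasFDerivAt.fun_sum (u := Finset.univ) fun j _ =>
    (hB i j).hasFDerivAt.mul (hasFDerivAt_pi'.1 hu j)
  refine h.congr_fderiv ?_
  ext v
  simp [h0, Matrix.mulVec, dotProduct]

end MulVec

/-! ### The error system along the section and its equilibria. -/

namespace OrientedLabelling

variable {n m : ℕ} {G : SimpleGraph (Fin n)} {E : OrientedLabelling G m}
  {d : Fin m → ℝ} {T : Finset (Fin m)} {y : MultiPoint n} {U : Set (T → ℝ)}
  {σ : (T → ℝ) → MultiPoint n}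

theorem contDiffOn_top_of_contDiffAt {X F : Type*} [NormedAddCommGroup X] [NormedSpace ℝ X]
    [NormedAddCommGroup F] [NormedSpace ℝ F] {f : X → F} {s : Set X}
    (h : ∀ x ∈ s, ContDiffAt ℝ ω f x) : ContDiffOn ℝ ∞ f s :=
  fun x hx => ((h x hx).of_le le_top).contDiffWithinAt

/-- A formation in the tube is congruent to `σ` at its reduced error, so inner products and rigidity
can be read off there. -/
theorem IsRigidSection.isAmbient (hn : 3 ≤ n) (hT : T.card = 2 * n - 3)
    (h : E.IsRigidSection d T y U σ) : E.IsAmbient d T y (E.tube d T U σ) where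
  isOpen := h.isOpen_tube hn
  mem := h.zero ▸ h.mem_tube h.zero_mem
  invariant Q hQ b x hx := moveBy_mem_tube hQ b hx
  inner i j k l := by
    refine ⟨fun ε => (σ ε i - σ ε j) ⬝ᵥ (σ ε k - σ ε l), ?_, ?_⟩
    · rw [h.image_tube]
      refine contDiffOn_top_of_contDiffAt fun ε hε => ?_
      have := h.contDiffAt ε hε
      simp only [Matrix.vec2_dotProduct, Pi.sub_apply]
      fun_prop
    · rintro x ⟨hU, Q, hQ, b, hb⟩
      have hx : ∀ i j, x i - x j =
          Q *ᵥ (σ (E.redErr d T x) i - σ (E.redErr d T x) j) := by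
        intro i j
        conv_lhs => rw [hb]
        simp [moveBy, Matrix.mulVec_sub]
      rw [hx, hx, mulVec_dotProduct_mulVec hQ]
  minInfRigid := by
    rintro x ⟨hU, Q, hQ, b, hb⟩
    rw [E.minInfRigidOn_iff hn hT, E.infRigidOn_iff_det hT, hb, E.Rred_gram_moveBy hQ,
      ← E.infRigidOn_iff_det hT]
    exact h.rigid _ hU

/-- The errors outside `T` along a section of the reduced error map. -/
def sectionHatErr (E : OrientedLabelling G m) (d : Fin m → ℝ) (T : Finset (Fin m))
    (σ : (T → ℝ) → MultiPoint n) (ε : T → ℝ) : ↥(Tᶜ) → ℝ := E.hatErr d T (σ ε)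

/-- The right-hand side of the error system along a section of the reduced error map. -/
noncomputable def sectionErrorSystem (E : OrientedLabelling G m) (d : Fin m → ℝ)
    (T : Finset (Fin m)) (σ : (T → ℝ) → MultiPoint n) (ε : T → ℝ) (μ : Fin m → ℝ) : T → ℝ :=
  (-2 : ℝ) • ((E.Rred T (σ ε) * (E.Rred T (σ ε))ᵀ) *ᵥ
      (ε + (jac (E.sectionHatErr d T σ) ε)ᵀ *ᵥ E.sectionHatErr d T σ ε))
    + (2 : ℝ) • ((E.Rred T (σ ε) * (E.S (σ ε))ᵀ) *ᵥ μ)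

theorem IsRigidSection.contDiffAt_hatErr (h : E.IsRigidSection d T y U σ) {ε : T → ℝ}
    (hε : ε ∈ U) : ContDiffAt ℝ ω (E.sectionHatErr d T σ) ε :=
  (E.contDiff_redErr d Tᶜ).contDiffAt.comp ε (h.contDiffAt ε hε)

theorem IsRigidSection.contDiffAt_jac (h : E.IsRigidSection d T y U σ) {ε : T → ℝ}
    (hε : ε ∈ U) (k : ↥(Tᶜ)) (l : T) :
    ContDiffAt ℝ ω (fun ε => jac (E.sectionHatErr d T σ) ε k l) ε := by
  have h1 : ContDiffAt ℝ ω (fderiv ℝ (E.sectionHatErr d T σ)) ε :=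
    (h.contDiffAt_hatErr hε).fderiv_right le_top
  have h2 := contDiffAt_pi.1 (h1.clm_apply (contDiffAt_const (c := (Pi.single l 1 : T → ℝ)))) k
  refine h2.congr_of_eventuallyEq (Filter.Eventually.of_forall fun ε => ?_)
  simp only [jac, LinearMap.toMatrix'_apply]
  congr 2

theorem IsRigidSection.isDependency (h : E.IsRigidSection d T y U σ) :
    E.IsDependency d T (E.tube d T U σ) (E.sectionHatErr d T σ) where
  smooth := by
    rw [h.image_tube]
    exact contDiffOn_top_of_contDiffAt fun ε hε => h.contDiffAt_hatErr hε
  eq := by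
    rintro x ⟨hU, Q, hQ, b, hb⟩
    conv_lhs => rw [hb]
    exact E.redErr_moveBy d Tᶜ hQ b _

section Differentiability

variable {p : (T → ℝ) × (Fin m → ℝ)}

theorem IsRigidSection.contDiffAt_gram_fst (h : E.IsRigidSection d T y U σ) (hp : p.1 ∈ U)
    (k l : T) : ContDiffAt ℝ ω (fun p : (T → ℝ) × (Fin m → ℝ) =>
      (E.Rred T (σ p.1) * (E.Rred T (σ p.1))ᵀ) k l) p :=
  (E.contDiff_gram T k l).contDiffAt.comp p ((h.contDiffAt _ hp).comp p contDiffAt_fst)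

theorem IsRigidSection.contDiffAt_Rred_mul_S_fst (h : E.IsRigidSection d T y U σ) (hp : p.1 ∈ U)
    (k : T) (l : Fin m) : ContDiffAt ℝ ω (fun p : (T → ℝ) × (Fin m → ℝ) =>
      (E.Rred T (σ p.1) * (E.S (σ p.1))ᵀ) k l) p :=
  (E.contDiff_Rred_mul_S T k l).contDiffAt.comp p ((h.contDiffAt _ hp).comp p contDiffAt_fst)

theorem IsRigidSection.contDiffAt_jac_fst (h : E.IsRigidSection d T y U σ) (hp : p.1 ∈ U)
    (l : T) (k : ↥(Tᶜ)) : ContDiffAt ℝ ω (fun p : (T → ℝ) × (Fin m → ℝ) =>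
      (jac (E.sectionHatErr d T σ) p.1)ᵀ l k) p :=
  (h.contDiffAt_jac hp k l).comp p contDiffAt_fst

theorem IsRigidSection.contDiffAt_errorSystem (h : E.IsRigidSection d T y U σ) (hp : p.1 ∈ U) :
    ContDiffAt ℝ ω (fun p : (T → ℝ) × (Fin m → ℝ) => E.sectionErrorSystem d T σ p.1 p.2) p := by
  unfold sectionErrorSystem
  refine ContDiffAt.add (ContDiffAt.const_smul _ ?_) (ContDiffAt.const_smul _ ?_)
  · refine ContDiffAt.matrix_mulVec (h.contDiffAt_gram_fst hp) (contDiffAt_fst.add ?_)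
    exact ContDiffAt.matrix_mulVec (h.contDiffAt_jac_fst hp)
      ((h.contDiffAt_hatErr hp).comp p contDiffAt_fst)
  · exact ContDiffAt.matrix_mulVec (h.contDiffAt_Rred_mul_S_fst hp) contDiffAt_snd

end Differentiability

theorem IsRigidSection.isErrorSystem (h : E.IsRigidSection d T y U σ) :
    E.IsErrorSystem d T (E.tube d T U σ) (E.sectionHatErr d T σ) (E.sectionErrorSystem d T σ) where
  smooth := by
    rw [h.image_tube]
    exact contDiffOn_top_of_contDiffAt fun p hp => h.contDiffAt_errorSystem hp.1
  eq := by
    rintro x ⟨hU, Q, hQ, b, hb⟩ μ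
    have h1 : E.Rred T x * (E.Rred T x)ᵀ =
        E.Rred T (σ (E.redErr d T x)) * (E.Rred T (σ (E.redErr d T x)))ᵀ := by
      conv_lhs => rw [hb]
      exact E.Rred_gram_moveBy hQ T b _
    have h2 : E.Rred T x * (E.S x)ᵀ =
        E.Rred T (σ (E.redErr d T x)) * (E.S (σ (E.redErr d T x)))ᵀ := by
      conv_lhs => rw [hb]
      exact E.Rred_mul_S_moveBy hQ T b _
    rw [h1, h2, sectionErrorSystem, Matrix.mulVec_add, smul_add, neg_smul, neg_smul, sub_eq_add_neg]

/-- The equilibrium equation of the error system can be solved analytically near `μ = 0`. -/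
theorem IsRigidSection.exists_equilibria (hT : T.card = 2 * n - 3)
    (h : E.IsRigidSection d T y U σ) (hy : ∀ k, E.err d y k = 0) :
    ∃ eps : (Fin m → ℝ) → (T → ℝ), ContDiffAt ℝ ω eps 0 ∧ eps 0 = 0 ∧
      ∀ᶠ μ in nhds 0, E.sectionErrorSystem d T σ (eps μ) μ = 0 := by
  have hU : ((0, 0) : (T → ℝ) × (Fin m → ℝ)).1 ∈ U := h.zero_mem
  have hψ0 : E.sectionHatErr d T σ 0 = 0 := by
    rw [sectionHatErr, h.zero]
    exact funext fun k => hy k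
  have hne : (ω : WithTop ℕ∞) ≠ 0 := by simp
  -- Adjoining `μ` as an output reduces the implicit equation to inverting `f`.
  let f : (T → ℝ) × (Fin m → ℝ) → (T → ℝ) × (Fin m → ℝ) := fun p =>
    (E.sectionErrorSystem d T σ p.1 p.2, p.2)
  have hf : ContDiffAt ℝ ω f (0, 0) := (h.contDiffAt_errorSystem hU).prodMk contDiffAt_snd
  have hf0 : f (0, 0) = (0, 0) := by
    simp [f, sectionErrorSystem, hψ0]
  have hψ := ((h.contDiffAt_hatErr h.zero_mem).differentiableAt hne).hasFDerivAt
  have hψ' := HasFDerivAt.comp (g := E.sectionHatErr d T σ)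
    (g' := fderiv ℝ (E.sectionHatErr d T σ) 0) (f := Prod.fst)
    ((0, 0) : (T → ℝ) × (Fin m → ℝ)) hψ hasFDerivAt_fst
  have h1 := HasFDerivAt.matrix_mulVec_of_eq_zero
    (fun i j => (h.contDiffAt_jac_fst hU i j).differentiableAt hne) hψ' hψ0
  have h2 := HasFDerivAt.matrix_mulVec_of_eq_zero
    (fun i j => (h.contDiffAt_gram_fst hU i j).differentiableAt hne)
    (hasFDerivAt_fst.add h1) (by simp [hψ0])
  have h3 := HasFDerivAt.matrix_mulVec_of_eq_zero (p := ((0, 0) : (T → ℝ) × (Fin m → ℝ)))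
    (fun i j => (h.contDiffAt_Rred_mul_S_fst hU i j).differentiableAt hne) hasFDerivAt_snd rfl
  have h4 := ((h2.const_smul (-2 : ℝ)).add (h3.const_smul (2 : ℝ))).prodMk
    (hasFDerivAt_snd (p := ((0, 0) : (T → ℝ) × (Fin m → ℝ))))
  -- Source and target have the same finite dimension, so injectivity suffices. As `ψ(0) = 0`, the
  -- derivative in `ε` is `-2 R̃ R̃'(I + F'F)`.
  obtain ⟨τ, hτ1, hτ2, hτ3⟩ := ContDiffAt.exists_local_section (f := f) hf h4 (by
    rw [← ContinuousLinearMap.coe_coe, ← LinearMap.injective_iff_surjective,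
      ← LinearMap.ker_eq_bot, LinearMap.ker_eq_bot']
    rintro ⟨δ, ν⟩ hδ
    have hν : ν = 0 := congrArg Prod.snd hδ
    subst hν
    have e1 : (-2 : ℝ) • ((E.Rred T (σ 0) * (E.Rred T (σ 0))ᵀ) *ᵥ
        (δ + (jac (E.sectionHatErr d T σ) 0)ᵀ *ᵥ fderiv ℝ (E.sectionHatErr d T σ) 0 δ))
        + (2 : ℝ) • ((E.Rred T (σ 0) * (E.S (σ 0))ᵀ) *ᵥ 0) = 0 := congrArg Prod.fst hδ
    rw [Matrix.mulVec_zero, smul_zero, add_zero, smul_eq_zero_iff_right (by norm_num)] at e1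
    have e2 := Matrix.eq_zero_of_mulVec_eq_zero
      ((E.infRigidOn_iff_det hT _).1 (h.rigid 0 h.zero_mem)) e1
    have e3 : fderiv ℝ (E.sectionHatErr d T σ) 0 δ = jac (E.sectionHatErr d T σ) 0 *ᵥ δ := by
      rw [jac, LinearMap.toMatrix'_mulVec]; rfl
    rw [e3] at e2
    -- Pairing `(I + F'F) δ = 0` with `δ` gives `‖δ‖² + ‖Fδ‖² = 0`.
    have e4 := congrArg (δ ⬝ᵥ ·) e2
    simp only [dotProduct_add, Matrix.mulVec_transpose, dotProduct_zero] at e4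
    rw [dotProduct_comm δ (_ ᵥ* _), ← Matrix.dotProduct_mulVec] at e4
    have e5 : 0 ≤ δ ⬝ᵥ δ := Finset.sum_nonneg fun i _ => mul_self_nonneg _
    have e6 : 0 ≤ jac (E.sectionHatErr d T σ) 0 *ᵥ δ ⬝ᵥ jac (E.sectionHatErr d T σ) 0 *ᵥ δ :=
      Finset.sum_nonneg fun i _ => mul_self_nonneg _
    rw [Prod.mk_eq_zero]
    exact ⟨dotProduct_self_eq_zero.1 (by linarith), rfl⟩)
  rw [hf0] at hτ1 hτ2 hτ3
  have hin : ContDiff ℝ ω fun μ : Fin m → ℝ => ((0, μ) : (T → ℝ) × (Fin m → ℝ)) := by fun_prop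
  refine ⟨fun μ => (τ (0, μ)).1, ?_, ?_, ?_⟩
  · exact contDiffAt_fst.comp _ (ContDiffAt.comp (g := τ) (0 : Fin m → ℝ) hτ1 hin.contDiffAt)
  · simp [hτ2]
  · filter_upwards [hin.continuous.continuousAt.eventually hτ3] with μ hμ
    have e2 : (τ (0, μ)).2 = μ := congrArg Prod.snd hμ
    have e1 : E.sectionErrorSystem d T σ (τ (0, μ)).1 (τ (0, μ)).2 = 0 := congrArg Prod.fst hμ
    rwa [e2] at e1

theorem exists_isSetting (hn : 3 ≤ n) (hy : E.IsTarget d y) (hT : E.MinInfRigidOn T y) :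
    ∃ A ψ g r M eps, E.IsSetting d T y A ψ g r M eps := by
  have hy0 : ∀ k, E.err d y k = 0 := fun k => sub_eq_zero.2 (hy.realizes k)
  obtain ⟨r, σ, hr, h⟩ := exists_isRigidSection hT (funext fun k => hy0 k)
  obtain ⟨eps, h1, h2, h3⟩ := h.exists_equilibria hT.card_eq hy0
  have h4 : ∀ᶠ μ in nhds 0, eps μ ∈ errBall T r :=
    h1.continuousAt.eventually_mem (by rw [h2]; exact h.isOpen.mem_nhds h.zero_mem)
  obtain ⟨M, hM, hMo, hM0⟩ := eventually_nhds_iff.1 (h3.and (h4.and (h1.eventually (by simp))))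
  -- The ball has half the radius of the section's domain, leaving room for the closure condition.
  refine ⟨E.tube d T (errBall T r) σ, E.sectionHatErr d T σ, E.sectionErrorSystem d T σ, r / 2, M,
    eps, h.isAmbient hn hT.card_eq, h.isDependency, h.isErrorSystem, half_pos hr, ?_,
    h.closure_ballPart_subset (half_pos hr) (half_lt_self hr), hMo, hM0,
    contDiffOn_top_of_contDiffAt fun μ hμ => (hM μ hμ).2.2, h2, ?_, fun μ hμ => (hM μ hμ).1⟩
  · rw [h.image_tube]
    intro ε hε
    have h5 : ∑ k, ε k ^ 2 < (r / 2) ^ 2 := hε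
    exact h5.trans (by nlinarith)
  · rw [h.image_tube]
    exact fun μ hμ => (hM μ hμ).2.1

end OrientedLabelling

theorem proposition3 {n m : ℕ} (hn : 3 ≤ n) (G : SimpleGraph (Fin n))
    (E : OrientedLabelling G m) (d : Fin m → ℝ) (y : MultiPoint n)
    (hy : E.IsTarget d y) (hun : Unaligned y) :
    (∃ T : Finset (Fin m), E.MinInfRigidOn T y) ∧
    ∀ T : Finset (Fin m), E.MinInfRigidOn T y →
      (∃ A ψ g r M eps, E.IsSetting d T y A ψ g r M eps) ∧
      ∀ A ψ g r M eps, E.IsSetting d T y A ψ g r M eps →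
        ∃ M₀ V : Set (Fin m → ℝ),
          IsOpen M₀ ∧ 0 ∈ M₀ ∧ M₀ ⊆ M ∧
          IsOpen V ∧ V ⊆ M₀ ∧ M₀ ⊆ closure V ∧
          ∀ μ ∈ M₀,
            (∃ x, E.IsEquilibriumSolution d T A ψ r eps μ x) ∧
            ∀ x, E.IsEquilibriumSolution d T A ψ r eps μ x →
              (E.NonconstantZ x ↔ μ ∈ V) :=
  ⟨E.exists_minInfRigidOn (hy.infRigid y hy.realizes), fun _ hT =>
    ⟨OrientedLabelling.exists_isSetting hn hy hT, fun _ _ _ _ _ _ h => h.exists_open_dense hn hy⟩⟩
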